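/- Let $k$ be a field with an embedding $k\hookrightarrow\mathbb{R}$ (for instance $k=\mathbb{Q}$), and let $\mathcal{Q}=\bigoplus_{m\ge 0}\mathcal{Q}_m$ be the graded Hopf algebra of quasisymmetric functions over $k$: $\mathcal Q_m$ is the span of the monomial functions $M_\alpha=\sum_{i_1<\dots<i_l}x_{i_1}^{a_1}\cdots x_{i_l}^{a_l}$ for $\alpha=(a_1,\dots,a_l)$ in the set $\mathrm{Comp}(m)$ of compositions of $m$; the product is that of power series, the coproduct is $\Delta(M_\alpha)=\sum_{\alpha=\beta\cdot\gamma}M_\beta\otimes M_\gamma$ (sum over deconcatenations), and the counit is $\varepsilon(M_\alpha)=\delta_{\alpha,()}$. For $\alpha\in\mathrm{Comp}(m)$ let $F_\alpha=\sum_{\beta\in\mathrm{Comp}(m),\ \beta\text{ refines }\alpha}M_\beta$ be the fundamental basis. For a permutation $\sigma\in\mathfrak{S}_n$ let $D(\sigma)\in\mathrm{Comp}(n)$ be its descent composition, i.e. the composition of $n$ whose proper partial sums form the descent set $\{i\in[n-1]:\sigma(i)>\sigma(i+1)\}$. Let $\Phi$ be a graded Hopf algebra endomorphism of $\mathcal{Q}$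 and $n\ge 0$. Define $c_{\alpha,\beta}\in k$ for $\alpha,\beta\in\mathrm{Comp}(n)$ by $\Phi(F_\alpha)=\sum_{\beta\in\mathrm{Comp}(n)}c_{\alpha,\beta}F_\beta$, and $\lambda\in k$ by $\Phi(M_{(1)})=\lambda M_{(1)}$. Suppose that $c_{\alpha,(n)}\ge 0$ for all $\alpha\in\mathrm{Comp}(n)$ and that $c_{\alpha,(n)}>0$ for some $\alpha\in\mathrm{Comp}(n)\setminus\{(n),1^n\}$. Put $$\mathrm{Prob}_\Phi(\pi)=\frac{c_{D(\pi),(n)}}{\sum_{\sigma\in\mathfrak{S}_n}c_{D(\sigma),(n)}},\qquad K(\pi,\sigma\pi)=\mathrm{Prob}_\Phi(\sigma^{-1})\quad(\pi,\sigma\in\mathfrak S_n),\qquad \overline K(\alpha,\beta)=\frac{c_{\alpha,\beta}}{\lambda^n}\quad(\alpha,\beta\in\mathrm{Comp}(n)).$$ Then $\lambda^n>0$, the matrices $K$ and $\overline K$ are stochastic, and $\overline K$ lumps $K$ by descent sets, i.e. $\overline K(D(\pi),\beta)=\sum_{\sigma:\,D(\sigma)=\beta}K(\pi,\sigma)$ for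 all $\pi\in\mathfrak S_n$ and $\beta\in\mathrm{Comp}(n)$. Moreover: 1. the uniform distribution on $\mathfrak{S}_n$ is the unique stationary distribution of $K$; 2. the distribution $\beta\mapsto|\{\sigma\in\mathfrak S_n:D(\sigma)=\beta\}|/n!$ of the descent sets of uniformly random permutations is the unique stationary distribution of $\overline K$; 3. for every $\alpha\in\mathrm{Comp}(n)\setminus\{(n),1^n\}$, the descent class $\{\sigma\in\mathfrak S_n:D(\sigma)=\alpha\}$ generates the group $\mathfrak{S}_n$. -/

import Mathlib

open scoped TensorProduct

/-! ### Quasisymmetric functions in the ordered variables `x₀, x₁, x₂, …` -/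

namespace QSym

/-- The word of nonzero exponents of a monomial, read in increasing order of the variables:
the exponent vector of `x_{i₁}^{a₁} ⋯ x_{iₖ}^{aₖ}` with `i₁ < ⋯ < iₖ` and all `aⱼ > 0` is sent to
`[a₁, …, aₖ]`. -/
def exponentWord {ι : Type*} [LinearOrder ι] (e : ι →₀ ℕ) : List ℕ :=
  e.support.sort.map e

/-- The monomial quasisymmetric function
`M_α = ∑_{i₁ < ⋯ < iₖ} x_{i₁}^{a₁} ⋯ x_{iₖ}^{aₖ}`, as a formal power series: the coefficient of a
monomial is `1` if its word of nonzero exponents is `α`, and `0` otherwise. -/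
def monomialSeries (k : Type*) [Field k] (α : Σ n : ℕ, Composition n) : MvPowerSeries ℕ k :=
  fun e => if exponentWord e = α.2.blocks then 1 else 0

theorem coeff_monomialSeries (k : Type*) [Field k] (α : Σ n : ℕ, Composition n) (e : ℕ →₀ ℕ) :
    MvPowerSeries.coeff e (monomialSeries k α) = if exponentWord e = α.2.blocks then 1 else 0 :=
  rfl

theorem exponentWord_embDomain {ι κ : Type*} [LinearOrder ι] [LinearOrder κ] (s : ι ↪o κ)
    (e : ι →₀ ℕ) : exponentWord (e.embDomain s.toEmbedding) = exponentWord e := by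
  unfold exponentWord
  have h := Finset.map_sort (r := (· ≤ ·)) (r' := (· ≤ ·)) (s := e.support) (f := s.toEmbedding)
    (fun a _ b _ => s.le_iff_le.symm)
  rw [Finsupp.support_embDomain]
  refine (congrArg (List.map (e.embDomain s.toEmbedding)) h.symm).trans ?_
  rw [List.map_map]
  congr 1
  funext i
  exact Finsupp.embDomain_apply_self _ _ _

/-- The canonical exponent vector with a given word. -/
noncomputable def wordFinsupp (w : List ℕ) : Fin w.length →₀ ℕ := Finsupp.equivFunOnFinite.symm w.get

theorem exists_embDomain (e : ℕ →₀ ℕ) :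
    ∃ s : Fin (exponentWord e).length ↪o ℕ,
      e = (wordFinsupp (exponentWord e)).embDomain s.toEmbedding := by
  have hcard : e.support.card = (exponentWord e).length := by simp [exponentWord]
  refine ⟨e.support.orderEmbOfFin hcard, ?_⟩
  ext i
  by_cases hi : i ∈ e.support
  · obtain ⟨j, rfl⟩ : i ∈ Set.range (e.support.orderEmbOfFin hcard) := by simpa using hi
    have h := Finsupp.embDomain_apply_self (e.support.orderEmbOfFin hcard).toEmbedding
      (wordFinsupp (exponentWord e)) j
    rw [show (e.support.orderEmbOfFin hcard) j
      = (e.support.orderEmbOfFin hcard).toEmbedding j from rfl, h]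
    rw [wordFinsupp, Finsupp.equivFunOnFinite_symm_apply_apply]
    refine Eq.trans ?_ (List.getElem_map (h := j.2) e).symm
    exact congrArg e (Finset.orderEmbOfFin_apply _ hcard j)
  · rw [Finsupp.embDomain_of_notMem_range]
    · simpa using hi
    · rintro ⟨j, rfl⟩
      exact hi (Finset.orderEmbOfFin_mem _ hcard j)

theorem sum_exponentWord (e : ℕ →₀ ℕ) : (exponentWord e).sum = e.sum fun _ a => a := by
  unfold exponentWord Finsupp.sum
  rw [← List.sum_toFinset _ (Finset.sort_nodup _ _), Finset.sort_toFinset]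

theorem pos_of_mem_exponentWord {e : ℕ →₀ ℕ} {a : ℕ} (h : a ∈ exponentWord e) : 0 < a := by
  simp only [exponentWord, List.mem_map, Finset.mem_sort, Finsupp.mem_support_iff] at h
  obtain ⟨i, hi, rfl⟩ := h
  exact Nat.pos_of_ne_zero hi

/-- The composition of the degree given by the exponents of a monomial. -/
def exponentComposition (e : ℕ →₀ ℕ) : Σ n : ℕ, Composition n :=
  ⟨(exponentWord e).sum, ⟨exponentWord e, pos_of_mem_exponentWord, rfl⟩⟩

theorem exponentWord_eq_iff (e : ℕ →₀ ℕ) (α : Σ n : ℕ, Composition n) :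
    exponentWord e = α.2.blocks ↔ exponentComposition e = α :=
  (Composition.sigma_eq_iff_blocks_eq (c := exponentComposition e) (c' := α)).symm

/-- A monomial with exponents `α`. -/
noncomputable def exponentOf (α : Σ n : ℕ, Composition n) : ℕ →₀ ℕ :=
  (wordFinsupp α.2.blocks).embDomain (Fin.valOrderEmb _).toEmbedding

theorem exponentWord_exponentOf (α : Σ n : ℕ, Composition n) :
    exponentWord (exponentOf α) = α.2.blocks := by
  unfold exponentOf
  rw [exponentWord_embDomain]
  have hs : (wordFinsupp α.2.blocks).support = Finset.univ := by
    ext i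
    simpa [wordFinsupp] using (α.2.blocks_pos (List.getElem_mem i.2)).ne'
  unfold exponentWord
  rw [hs, Fin.sort_univ]
  apply List.ext_getElem <;> simp [wordFinsupp]

theorem exponentComposition_exponentOf (α : Σ n : ℕ, Composition n) :
    exponentComposition (exponentOf α) = α :=
  (exponentWord_eq_iff _ _).1 (exponentWord_exponentOf α)

theorem coeff_exponentOf (k : Type*) [Field k] (α β : Σ n : ℕ, Composition n) :
    MvPowerSeries.coeff (exponentOf β) (monomialSeries k α) = if β = α then 1 else 0 := by
  rw [coeff_monomialSeries]
  simp only [exponentWord_eq_iff, exponentComposition_exponentOf]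

/-- A power series that is homogeneous of degree `N` and whose coefficients depend only on the word
of nonzero exponents is a linear combination of monomial quasisymmetric functions. -/
theorem mem_span_of_invariant {k : Type*} [Field k] (f : MvPowerSeries ℕ k) (N : ℕ)
    (hdeg : ∀ e : ℕ →₀ ℕ, (exponentWord e).sum ≠ N → MvPowerSeries.coeff e f = 0)
    (hinv : ∀ e e' : ℕ →₀ ℕ, exponentWord e = exponentWord e' →
      MvPowerSeries.coeff e f = MvPowerSeries.coeff e' f) :
    f ∈ Submodule.span k (Set.range (monomialSeries k)) := by
  have hf : f = ∑ γ : Composition N,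
      MvPowerSeries.coeff (exponentOf ⟨N, γ⟩) f • monomialSeries k ⟨N, γ⟩ := by
    ext e
    simp only [map_sum, map_smul, coeff_monomialSeries, smul_eq_mul, mul_ite, mul_one, mul_zero]
    by_cases he : (exponentWord e).sum = N
    · subst he
      let γ₀ : Composition (exponentWord e).sum := (exponentComposition e).2
      rw [Finset.sum_eq_single γ₀]
      · rw [if_pos (show exponentWord e = γ₀.blocks from rfl)]
        exact hinv _ _ (exponentWord_exponentOf (exponentComposition e)).symm
      · intro γ _ hγ
        rw [if_neg]
        intro h
        exact hγ (Composition.ext h.symm)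
      · simp
    · rw [hdeg e he]
      symm
      apply Finset.sum_eq_zero
      intro γ _
      rw [if_neg]
      intro h
      exact he (h ▸ γ.blocks_sum)
  rw [hf]
  exact Submodule.sum_mem _ fun γ _ => Submodule.smul_mem _ _ (Submodule.subset_span ⟨_, rfl⟩)

theorem coeff_mul_embDomain {k : Type*} [Field k] (f g : MvPowerSeries ℕ k)
    {l : ℕ} (e : Fin l →₀ ℕ) (s : Fin l ↪o ℕ) :
    MvPowerSeries.coeff (e.embDomain s.toEmbedding) (f * g)
      = ∑ p ∈ Finset.HasAntidiagonal.antidiagonal e, MvPowerSeries.coeff (p.1.embDomain s.toEmbedding) f *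
          MvPowerSeries.coeff (p.2.embDomain s.toEmbedding) g := by
  rw [MvPowerSeries.coeff_mul]
  have hemb : ∀ x y : Fin l →₀ ℕ, (x + y).embDomain s.toEmbedding
      = x.embDomain s.toEmbedding + y.embDomain s.toEmbedding := by
    intro x y
    simp only [Finsupp.embDomain_eq_mapDomain, Finsupp.mapDomain_add]
  symm
  refine Finset.sum_bij
    (fun p _ => (p.1.embDomain s.toEmbedding, p.2.embDomain s.toEmbedding)) ?_ ?_ ?_ ?_
  · intro p hp
    rw [Finset.HasAntidiagonal.mem_antidiagonal] at hp ⊢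
    rw [← hemb, hp]
  · intro p _ q _ h
    rw [Prod.mk.injEq] at h
    exact Prod.ext (Finsupp.embDomain_injective _ h.1) (Finsupp.embDomain_injective _ h.2)
  · rintro ⟨a, b⟩ hab
    rw [Finset.HasAntidiagonal.mem_antidiagonal] at hab
    have hzero : ∀ i, i ∉ Set.range s.toEmbedding → a i = 0 ∧ b i = 0 := by
      intro i hi
      have := DFunLike.congr_fun hab i
      rw [Finsupp.embDomain_of_notMem_range _ _ _ hi] at this
      simpa using this
    have hpre : ∀ c : ℕ →₀ ℕ, (∀ i, i ∉ Set.range s.toEmbedding → c i = 0) →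
        (Finsupp.equivFunOnFinite.symm (fun i => c (s i))).embDomain s.toEmbedding = c := by
      intro c hc
      ext i
      by_cases hi : i ∈ Set.range s.toEmbedding
      · obtain ⟨j, rfl⟩ := hi
        rw [Finsupp.embDomain_apply_self]
        rfl
      · rw [Finsupp.embDomain_of_notMem_range _ _ _ hi, hc i hi]
    have ha := hpre a fun i hi => (hzero i hi).1
    have hb := hpre b fun i hi => (hzero i hi).2
    refine ⟨(Finsupp.equivFunOnFinite.symm (fun i => a (s i)),
      Finsupp.equivFunOnFinite.symm (fun i => b (s i))), ?_, ?_⟩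
    · rw [Finset.HasAntidiagonal.mem_antidiagonal]
      apply Finsupp.embDomain_injective s.toEmbedding
      dsimp only
      rw [hemb, ha, hb, hab]
    · exact Prod.ext ha hb
  · intro p _
    rfl

theorem monomialSeries_mul_mem (k : Type*) [Field k] (α β : Σ n : ℕ, Composition n) :
    monomialSeries k α * monomialSeries k β
      ∈ Submodule.span k (Set.range (monomialSeries k)) := by
  refine mem_span_of_invariant _ (α.1 + β.1) ?_ ?_
  · intro e he
    rw [MvPowerSeries.coeff_mul]
    apply Finset.sum_eq_zero
    rintro ⟨a, b⟩ hab
    rw [Finset.HasAntidiagonal.mem_antidiagonal] at hab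
    simp only [coeff_monomialSeries]
    by_cases h1 : exponentWord a = α.2.blocks
    · by_cases h2 : exponentWord b = β.2.blocks
      · exfalso
        apply he
        have ha := sum_exponentWord a
        have hb := sum_exponentWord b
        rw [h1, α.2.blocks_sum] at ha
        rw [h2, β.2.blocks_sum] at hb
        rw [sum_exponentWord, ← hab, Finsupp.sum_add_index' (fun _ => rfl) (fun _ _ _ => rfl),
          ← ha, ← hb]
      · simp [h2]
    · simp [h1]
  · intro e e' h
    obtain ⟨s, hs⟩ := exists_embDomain e
    obtain ⟨s', hs'⟩ := exists_embDomain e'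
    generalize exponentWord e' = w at h s' hs'
    subst h
    rw [hs, hs', coeff_mul_embDomain, coeff_mul_embDomain]
    simp only [coeff_monomialSeries, exponentWord_embDomain]

theorem monomialSeries_empty (k : Type*) [Field k] :
    monomialSeries k ⟨0, Composition.ones 0⟩ = 1 := by
  ext e
  rw [coeff_monomialSeries, MvPowerSeries.coeff_one]
  congr 1
  simp only [Composition.ones_blocks, List.replicate_zero, eq_iff_iff]
  rw [← List.length_eq_zero_iff]
  simp [exponentWord]

theorem span_mul_mem (k : Type*) [Field k] (f g : MvPowerSeries ℕ k)
    (hf : f ∈ Submodule.span k (Set.range (monomialSeries k)))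
    (hg : g ∈ Submodule.span k (Set.range (monomialSeries k))) :
    f * g ∈ Submodule.span k (Set.range (monomialSeries k)) := by
  induction hf using Submodule.span_induction with
  | mem x hx =>
    obtain ⟨α, rfl⟩ := hx
    induction hg using Submodule.span_induction with
    | mem y hy =>
      obtain ⟨β, rfl⟩ := hy
      exact monomialSeries_mul_mem k α β
    | zero => rw [mul_zero]; exact Submodule.zero_mem _
    | add y z _ _ hy hz => rw [mul_add]; exact Submodule.add_mem _ hy hz
    | smul c y _ hy => rw [mul_smul_comm]; exact Submodule.smul_mem _ _ hy
  | zero => rw [zero_mul]; exact Submodule.zero_mem _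
  | add y z _ _ hy hz => rw [add_mul]; exact Submodule.add_mem _ hy hz
  | smul c y _ hy => rw [smul_mul_assoc]; exact Submodule.smul_mem _ _ hy

/-- The algebra of quasisymmetric functions over `k`: the linear span of the monomial
quasisymmetric functions, with the product of formal power series. -/
noncomputable def quasisymmetric (k : Type*) [Field k] : Subalgebra k (MvPowerSeries ℕ k) :=
  (Submodule.span k (Set.range (monomialSeries k))).toSubalgebra
    (Submodule.subset_span ⟨_, monomialSeries_empty k⟩) (span_mul_mem k)

/-- `M_α` as an element of the algebra of quasisymmetric functions. -/
noncomputable def M (k : Type*) [Field k] (α : Σ n : ℕ, Composition n) : quasisymmetric k :=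
  ⟨monomialSeries k α, Submodule.subset_span ⟨α, rfl⟩⟩

theorem linearIndependent_M (k : Type*) [Field k] : LinearIndependent k (M k) := by
  rw [linearIndependent_iff']
  intro s g hg β hβ
  have h := congrArg
    (fun f : quasisymmetric k => MvPowerSeries.coeff (exponentOf β) (f : MvPowerSeries ℕ k)) hg
  simp only [AddSubmonoidClass.coe_finsetSum, map_sum] at h
  have h2 : ∑ α ∈ s, g α * (if β = α then (1 : k) else 0) = 0 := by
    refine Eq.trans (Finset.sum_congr rfl fun α _ => ?_) (h.trans (map_zero _))
    rw [← coeff_exponentOf]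
    rfl
  simpa [hβ] using h2

theorem span_M (k : Type*) [Field k] : ⊤ ≤ Submodule.span k (Set.range (M k)) := by
  rintro ⟨f, hf⟩ -
  have hf' : f ∈ Submodule.span k (Set.range (monomialSeries k)) := hf
  have key : ∀ f (hf : f ∈ Submodule.span k (Set.range (monomialSeries k))),
      (⟨f, hf⟩ : quasisymmetric k) ∈ Submodule.span k (Set.range (M k)) := by
    intro f hf
    induction hf using Submodule.span_induction with
    | mem x hx => obtain ⟨α, rfl⟩ := hx; exact Submodule.subset_span ⟨α, rfl⟩
    | zero => exact Submodule.zero_mem _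
    | add y z _ _ hy hz => exact Submodule.add_mem _ hy hz
    | smul c y _ hy => exact Submodule.smul_mem _ c hy
  exact key f hf'

/-- The monomial basis `(M_α)`. -/
noncomputable def monomialBasis (k : Type*) [Field k] :
    Module.Basis (Σ n : ℕ, Composition n) k (quasisymmetric k) :=
  Module.Basis.mk (linearIndependent_M k) (span_M k)

/-- The composition formed by the first `i` parts of `α`. -/
def takeParts (α : Σ n : ℕ, Composition n) (i : ℕ) : Σ n : ℕ, Composition n :=
  ⟨(α.2.blocks.take i).sum,
    ⟨α.2.blocks.take i, fun h => α.2.blocks_pos (List.mem_of_mem_take h), rfl⟩⟩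

/-- The composition formed by the parts of `α` after the first `i` ones. -/
def dropParts (α : Σ n : ℕ, Composition n) (i : ℕ) : Σ n : ℕ, Composition n :=
  ⟨(α.2.blocks.drop i).sum,
    ⟨α.2.blocks.drop i, fun h => α.2.blocks_pos (List.mem_of_mem_drop h), rfl⟩⟩

/-- The coproduct `Δ(M_α) = ∑_{α = β · γ} M_β ⊗ M_γ` (sum over the ways of writing `α` as the
concatenation of two possibly empty compositions) and the counit `ε(M_α) = δ_{α, ()}`. -/
noncomputable instance (k : Type*) [Field k] : CoalgebraStruct k (quasisymmetric k) where
  comul := (monomialBasis k).constr k fun α =>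
    ∑ i ∈ Finset.range (α.2.length + 1), M k (takeParts α i) ⊗ₜ[k] M k (dropParts α i)
  counit := (monomialBasis k).constr k fun α => if α.2.length = 0 then 1 else 0

/-- The homogeneous component of degree `n`, spanned by the `M_α` with `α` a composition of `n`. -/
noncomputable def homogeneousPart (k : Type*) [Field k] (n : ℕ) : Submodule k (quasisymmetric k) :=
  Submodule.span k (Set.range fun α : Composition n => M k ⟨n, α⟩)

/-- The refinement order on compositions of `n`: `β` refines `α` if every partial sum of `α` is a
partial sum of `β`. (`Composition.boundaries` is the set of partial sums, including `0` and `n`.) -/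
def Refines {n : ℕ} (α β : Composition n) : Prop := α.boundaries ⊆ β.boundaries

instance {n : ℕ} (α β : Composition n) : Decidable (Refines α β) :=
  inferInstanceAs (Decidable (α.boundaries ⊆ β.boundaries))

/-- The fundamental quasisymmetric function `F_α = ∑_{β ≥ α} M_β`. -/
noncomputable def F (k : Type*) [Field k] (α : Σ n : ℕ, Composition n) : quasisymmetric k :=
  ∑ β : Composition α.1 with Refines α.2 β, M k ⟨α.1, β⟩

theorem boundaries_injective {n : ℕ} {α β : Composition n} (h : α.boundaries = β.boundaries) :
    α = β :=
  (compositionEquiv n).injective (CompositionAsSet.ext h)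

theorem linearIndependent_F (k : Type*) [Field k] : LinearIndependent k (F k) := by
  rw [linearIndependent_iff']
  intro s g hg
  have hcoef : ∀ (n : ℕ) (β : Composition n),
      ∑ α ∈ s, g α * (if ∃ γ : Composition n, α = ⟨n, γ⟩ ∧ Refines γ β then (1 : k) else 0) = 0 := by
    intro n β
    have h := congrArg (fun f => (monomialBasis k).repr f ⟨n, β⟩) hg
    simp only [map_sum, map_smul, Finsupp.coe_finsetSum, Finset.sum_apply, Finsupp.coe_smul,
      Pi.smul_apply, smul_eq_mul, map_zero, Finsupp.coe_zero, Pi.zero_apply] at h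
    refine Eq.trans (Finset.sum_congr rfl fun α _ => ?_) h
    congr 1
    have hM : ∀ γ, (monomialBasis k).repr (M k γ) = Finsupp.single γ 1 := by
      intro γ
      rw [← Module.Basis.repr_self (monomialBasis k) γ, monomialBasis, Module.Basis.mk_apply]
    unfold F
    rw [map_sum]
    simp only [hM, Finsupp.coe_finsetSum, Finset.sum_apply, Finsupp.single_apply]
    obtain ⟨m, α⟩ := α
    by_cases hmn : m = n
    · subst hmn
      simp only [Sigma.mk.injEq, heq_eq_eq, true_and]
      simp [Finset.sum_ite_eq']
    · have : ∀ γ : Composition n, (⟨m, α⟩ : Σ n, Composition n) ≠ ⟨n, γ⟩ :=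
        fun γ h => hmn (congrArg Sigma.fst h)
      have h2 : ∀ γ : Composition m, (⟨m, γ⟩ : Σ n, Composition n) ≠ ⟨n, β⟩ :=
        fun γ h => hmn (congrArg Sigma.fst h)
      simp [this, h2]
  have main : ∀ (c n : ℕ) (β : Composition n), β.boundaries.card = c →
      (⟨n, β⟩ : Σ n, Composition n) ∈ s → g ⟨n, β⟩ = 0 := by
    intro c
    induction c using Nat.strong_induction_on with
    | _ c ih =>
      intro n β hc hβ
      have h := hcoef n β
      rw [Finset.sum_eq_single_of_mem _ hβ] at h
      · rw [if_pos ⟨β, rfl, Finset.Subset.refl _⟩, mul_one] at h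
        exact h
      · intro α hα hne
        split_ifs with hex
        · obtain ⟨γ, rfl, hγ⟩ := hex
          rw [ih _ _ n γ rfl hα, zero_mul]
          rw [← hc]
          refine Finset.card_lt_card (Finset.ssubset_iff_subset_ne.2 ⟨hγ, fun h => hne ?_⟩)
          rw [boundaries_injective h]
        · rw [mul_zero]
  intro α hα
  exact main _ α.1 α.2 rfl hα

theorem span_F (k : Type*) [Field k] : ⊤ ≤ Submodule.span k (Set.range (F k)) := by
  have main : ∀ (c n : ℕ) (α : Composition n), n + 1 - α.boundaries.card = c →
      M k ⟨n, α⟩ ∈ Submodule.span k (Set.range (F k)) := by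
    intro c
    induction c using Nat.strong_induction_on with
    | _ c ih =>
      intro n α hc
      have hF : F k ⟨n, α⟩ = M k ⟨n, α⟩ +
          ∑ β ∈ (Finset.univ.filter fun β : Composition n => Refines α β).erase α, M k ⟨n, β⟩ := by
        unfold F
        exact (Finset.add_sum_erase (Finset.univ.filter fun β : Composition n => Refines α β)
          (fun β => M k ⟨n, β⟩) (Finset.mem_filter.2 ⟨Finset.mem_univ _, Finset.Subset.refl _⟩)).symm
      rw [eq_sub_of_add_eq hF.symm]
      refine Submodule.sub_mem _ (Submodule.subset_span ⟨_, rfl⟩) (Submodule.sum_mem _ ?_)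
      intro β hβ
      rw [Finset.mem_erase, Finset.mem_filter] at hβ
      refine ih _ ?_ n β rfl
      have h1 : α.boundaries.card < β.boundaries.card :=
        Finset.card_lt_card (Finset.ssubset_iff_subset_ne.2
          ⟨hβ.2.2, fun h => hβ.1 (boundaries_injective h).symm⟩)
      have h2 : β.boundaries.card ≤ n + 1 := by
        simpa using Finset.card_le_univ β.boundaries
      omega
  refine (span_M k).trans (Submodule.span_le.2 ?_)
  rintro _ ⟨α, rfl⟩
  exact main _ α.1 α.2 rfl

/-- The fundamental basis `(F_α)`. -/
noncomputable def fundamentalBasis (k : Type*) [Field k] :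
    Module.Basis (Σ n : ℕ, Composition n) k (quasisymmetric k) :=
  Module.Basis.mk (linearIndependent_F k) (span_F k)

/-- A linear map `Φ` of quasisymmetric functions is graded if it preserves every homogeneous
component. -/
def IsGraded {k : Type*} [Field k] (Φ : quasisymmetric k →ₐc[k] quasisymmetric k) : Prop :=
  ∀ (m : ℕ) (f : quasisymmetric k), f ∈ homogeneousPart k m → Φ f ∈ homogeneousPart k m

/-- The coefficient `c_{α,β}` in `Φ(F_α) = ∑_β c_{α,β} F_β`. -/
noncomputable def coeffF {k : Type*} [Field k] (Φ : quasisymmetric k →ₐc[k] quasisymmetric k)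
    {n : ℕ} (α β : Composition n) : k :=
  (fundamentalBasis k).repr (Φ (F k ⟨n, α⟩)) ⟨n, β⟩

/-- The scalar `λ` in `Φ(M_(1)) = λ M_(1)`. -/
noncomputable def scalar {k : Type*} [Field k]
    (Φ : quasisymmetric k →ₐc[k] quasisymmetric k) : k :=
  (monomialBasis k).repr (Φ (M k ⟨1, Composition.ones 1⟩)) ⟨1, Composition.ones 1⟩

end QSym

/-! ### Descents, and the two Markov chains -/

namespace QSymWalk

open QSym

/-- The composition `(n)` of `n` (the empty composition if `n = 0`). -/
def onePart (n : ℕ) : Composition n :=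
  if h : 0 < n then Composition.single n h else (Composition.ones 0).cast (by omega)

/-- The descent set of a permutation of `{0, …, n-1}`: positions `i` with `σ(i) > σ(i+1)`. -/
def descentSet {n : ℕ} (σ : Equiv.Perm (Fin n)) : Finset (Fin (n - 1)) :=
  Finset.univ.filter fun i => σ ⟨i + 1, by omega⟩ < σ ⟨i, by omega⟩

/-- The descent composition `D(σ)`: the composition of `n` whose proper partial sums are the `i + 1`
with `i` in `descentSet σ`. -/
def descentComposition {n : ℕ} (σ : Equiv.Perm (Fin n)) : Composition n :=
  (compositionEquiv n).symm ((compositionAsSetEquiv n).symm (descentSet σ))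

variable {k : Type*} [Field k] [Algebra k ℝ]

/-- The probability `c_{D(π),(n)} / ∑_σ c_{D(σ),(n)}` of a permutation `π`. -/
noncomputable def prob (Φ : quasisymmetric k →ₐc[k] quasisymmetric k) {n : ℕ}
    (π : Equiv.Perm (Fin n)) : ℝ :=
  algebraMap k ℝ (coeffF Φ (descentComposition π) (onePart n)) /
    ∑ σ : Equiv.Perm (Fin n), algebraMap k ℝ (coeffF Φ (descentComposition σ) (onePart n))

/-- The transition matrix `K`, with `K(π, σπ) = Prob(σ⁻¹)`; here `τ = σπ`, so `σ = τ π⁻¹`. -/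
noncomputable def K (Φ : quasisymmetric k →ₐc[k] quasisymmetric k) (n : ℕ) :
    Matrix (Equiv.Perm (Fin n)) (Equiv.Perm (Fin n)) ℝ :=
  fun π τ => prob Φ (τ * π⁻¹)⁻¹

/-- The matrix `K̄(α, β) = c_{α,β} / λⁿ`. -/
noncomputable def Kbar (Φ : quasisymmetric k →ₐc[k] quasisymmetric k) (n : ℕ) :
    Matrix (Composition n) (Composition n) ℝ :=
  fun α β => algebraMap k ℝ (coeffF Φ α β) / algebraMap k ℝ (scalar Φ) ^ n

/-- `μ` is a stationary distribution of the transition matrix `P`: a probability vector with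
`μ P = μ`. -/
def IsStationary {ι : Type*} [Fintype ι] (P : Matrix ι ι ℝ) (μ : ι → ℝ) : Prop :=
  μ ∈ stdSimplex ℝ ι ∧ Matrix.vecMul μ P = μ

/-- The uniform distribution on permutations. -/
noncomputable def uniformDist (n : ℕ) : Equiv.Perm (Fin n) → ℝ := fun _ => 1 / (n.factorial : ℝ)

/-- The distribution of the descent composition (equivalently, of the descent set) of a uniformly
random permutation. -/
noncomputable def descentDist (n : ℕ) : Composition n → ℝ := fun β =>
  ((Finset.univ.filter fun σ : Equiv.Perm (Fin n) => descentComposition σ = β).card : ℝ) /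
    (n.factorial : ℝ)

end QSymWalk

/-! For f homogeneous of degree n, let ζ(f) be the coefficient of M_(n) in Φ(f). Everything about
the two chains rests on the convolution formula `map_F_descentComposition`: Φ(F_{D(π)}) = ∑_τ
ζ(F_{D(πτ⁻¹)}) F_{D(τ)}.

The coefficient of M_(n) is the coefficient of x₀ⁿ, so ζ is multiplicative. Since Φ is graded and
respects Δ, and Δ cuts a word into consecutive pieces, the coefficient of M_β in Φ(F_{D(π)}) is the
product of the values of ζ on the pieces of π whose lengths are the parts of β
(`coord_append_map_fundamental`). By multiplicativity this is ζ of the product of the fundamental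
functions of the pieces, which is a sum over shuffles π∘τ⁻¹, where τ runs over the permutations with
descents among the partial sums of β (`shuffleSum_add`). The same condition on τ says that M_β
occurs in F_{D(τ)}, so the two sides have equal coordinates (`coord_map_fundamental`).

As M_(n) occurs in F_(n) only, c_{α,(n)} = ζ(F_α). The formula then is the lumping identity up to
the factor λⁿ, and M_(1)ⁿ = ∑_σ F_{D(σ)} identifies λⁿ with the normalising sum.

K is a random walk on a group, so the uniform distribution is stationary, and its image under D is
stationary for K̄. For uniqueness, the maximum principle makes harmonic functions constant once the
support of the steps generates the group; harmonic functions of K̄ lift to K. The left and right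
kernels of 1 - P have the same dimension (`IsStationary.unique`).

For generation, a descent set that is neither empty nor full forces a peak or valley at an interior
position p, and some member of the class has an extreme value e there. Exchanging consecutive values
on different sides of p preserves descents, which yields all transpositions avoiding e
(`swap_mem_of_side`). Conjugating one of them by that member brings in e. -/

namespace QSymWalk

open QSym

/-! ### Partial sums of lists and the refinement order -/

/-- The partial sums of a list of natural numbers. -/
def cuts (l : List ℕ) : Set ℕ := {i | ∃ j, (l.take j).sum = i}

theorem sum_take_le_sum (l : List ℕ) (j : ℕ) : (l.take j).sum ≤ l.sum := by
  conv_rhs => rw [← List.take_append_drop j l, List.sum_append]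
  exact Nat.le_add_right _ _

theorem le_sum_of_mem_cuts {l : List ℕ} {i : ℕ} (h : i ∈ cuts l) : i ≤ l.sum := by
  obtain ⟨j, rfl⟩ := h
  exact sum_take_le_sum l j

theorem mem_cuts_append {l₁ l₂ : List ℕ} {i : ℕ} :
    i ∈ cuts (l₁ ++ l₂) ↔ i ∈ cuts l₁ ∨ ∃ j ∈ cuts l₂, l₁.sum + j = i := by
  constructor
  · rintro ⟨j, rfl⟩
    rw [List.take_append]
    by_cases hj : j ≤ l₁.length
    · left
      exact ⟨j, by simp [Nat.sub_eq_zero_of_le hj]⟩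
    · right
      refine ⟨_, ⟨j - l₁.length, rfl⟩, ?_⟩
      rw [List.sum_append, List.take_of_length_le (by omega : l₁.length ≤ j)]
  · rintro (⟨j, rfl⟩ | ⟨_, ⟨j, rfl⟩, rfl⟩)
    · refine ⟨min j l₁.length, ?_⟩
      rw [List.take_append_of_le_length (min_le_right _ _)]
      simp [← List.take_eq_take_min]
    · refine ⟨l₁.length + j, ?_⟩
      rw [List.take_append, List.take_of_length_le (by omega : l₁.length ≤ _)]
      simp

theorem mem_cuts_append_lt {l₁ l₂ : List ℕ} {i : ℕ} (h : i < l₁.sum) :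
    i ∈ cuts (l₁ ++ l₂) ↔ i ∈ cuts l₁ := by
  rw [mem_cuts_append, or_iff_left]
  rintro ⟨j, -, rfl⟩
  omega

theorem sum_mem_cuts (l : List ℕ) : l.sum ∈ cuts l := ⟨l.length, by simp⟩

theorem zero_mem_cuts (l : List ℕ) : 0 ∈ cuts l := ⟨0, by simp⟩

theorem add_mem_cuts_append {l₁ l₂ : List ℕ} {j : ℕ} :
    l₁.sum + j ∈ cuts (l₁ ++ l₂) ↔ j ∈ cuts l₂ := by
  rw [mem_cuts_append]
  constructor
  · rintro (h | ⟨i, hi, h⟩)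
    · have := le_sum_of_mem_cuts h
      obtain rfl : j = 0 := by omega
      exact zero_mem_cuts _
    · obtain rfl : i = j := by omega
      exact hi
  · exact fun h => Or.inr ⟨j, h, rfl⟩

theorem mem_boundaries_iff {n : ℕ} (c : Composition n) (i : Fin (n + 1)) :
    i ∈ c.boundaries ↔ (i : ℕ) ∈ cuts c.blocks := by
  simp only [Composition.boundaries, Finset.mem_map, Finset.mem_univ, true_and, cuts,
    Set.mem_ofPred_eq]
  constructor
  · rintro ⟨j, rfl⟩
    exact ⟨j, rfl⟩
  · rintro ⟨j, hj⟩
    by_cases h : j < c.length + 1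
    · exact ⟨⟨j, h⟩, Fin.ext hj⟩
    · refine ⟨Fin.last _, ?_⟩
      rw [← Composition.sizeUpTo, Composition.sizeUpTo_ofLength_le _ _ (by omega)] at hj
      apply Fin.ext
      exact (c.sizeUpTo_length).trans hj

theorem refines_iff_cuts {n : ℕ} (α β : Composition n) :
    Refines α β ↔ cuts α.blocks ⊆ cuts β.blocks := by
  constructor
  · intro h i hi
    have hle := le_sum_of_mem_cuts hi
    rw [α.blocks_sum] at hle
    have := h ((mem_boundaries_iff α ⟨i, by omega⟩).2 hi)
    exact (mem_boundaries_iff β _).1 this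
  · intro h i hi
    exact (mem_boundaries_iff β _).2 (h ((mem_boundaries_iff α _).1 hi))

/-! ### Descents of words and descent compositions -/

/-- The descents of a word `w₀ ⋯ wₙ₋₁`: the positions `i + 1` with `wᵢ > wᵢ₊₁`. -/
def descents {α : Type*} [LinearOrder α] {n : ℕ} (w : Fin n → α) : Set ℕ :=
  {j | ∃ (i : ℕ) (hi : i + 1 < n), j = i + 1 ∧ w ⟨i + 1, hi⟩ < w ⟨i, by omega⟩}

theorem descents_congr {α β : Type*} [LinearOrder α] [LinearOrder β] {n : ℕ} {w : Fin n → α}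
    {v : Fin n → β} (h : ∀ i j, w i < w j ↔ v i < v j) : descents w = descents v := by
  unfold descents
  simp only [h]

theorem succ_mem_descents {α : Type*} [LinearOrder α] {n : ℕ} {w : Fin n → α} {i : ℕ}
    (hi : i + 1 < n) : i + 1 ∈ descents w ↔ w ⟨i + 1, hi⟩ < w ⟨i, by omega⟩ := by
  constructor
  · rintro ⟨i', hi', h, hlt⟩
    obtain rfl : i = i' := by omega
    exact hlt
  · exact fun h => ⟨i, hi, rfl, h⟩

theorem descents_subset_iff {α : Type*} [LinearOrder α] {n : ℕ} {w : Fin n → α} {S : Set ℕ} :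
    descents w ⊆ S ↔
      ∀ (i : ℕ) (hi : i + 1 < n), w ⟨i + 1, hi⟩ < w ⟨i, by omega⟩ → i + 1 ∈ S := by
  constructor
  · intro h i hi hlt
    exact h ⟨i, hi, rfl, hlt⟩
  · rintro h _ ⟨i, hi, rfl, hlt⟩
    exact h i hi hlt

/-- Descents of a word that is cut at a position of `S` can be checked on the two halves. -/
theorem descents_subset_add_iff {α : Type*} [LinearOrder α] {b c : ℕ} {w : Fin (b + c) → α}
    {S : Set ℕ} (hb : b ∈ S) :
    descents w ⊆ S ↔ descents (fun i => w (Fin.castAdd c i)) ⊆ S ∧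
      descents (fun i => w (Fin.natAdd b i)) ⊆ {j | b + j ∈ S} := by
  simp only [descents_subset_iff]
  constructor
  · intro h
    refine ⟨fun i hi hlt => h i (by omega) hlt, fun i hi hlt => ?_⟩
    exact h (b + i) (by omega) hlt
  · rintro ⟨h1, h2⟩ i hi hlt
    rcases lt_trichotomy (i + 1) b with hlt' | rfl | hgt
    · exact h1 i hlt' hlt
    · exact hb
    · obtain ⟨j, rfl⟩ : ∃ j, i = b + j := ⟨i - b, by omega⟩
      exact h2 j (by omega) hlt

/-- Translates the descent composition, built through `Fin (n - 1)` and `CompositionAsSet`, into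
subsets of ℕ. The endpoints 0 and n are always partial sums and carry no information. -/
theorem mem_cuts_descentComposition {n : ℕ} (σ : Equiv.Perm (Fin n)) (j : ℕ) :
    j ∈ cuts (descentComposition σ).blocks ↔ j = 0 ∨ j = n ∨ j ∈ descents σ := by
  by_cases hj : j < n + 1
  · rw [show j = ((⟨j, hj⟩ : Fin (n + 1)) : ℕ) from rfl, ← mem_boundaries_iff]
    have : (descentComposition σ).boundaries
        = ((compositionAsSetEquiv n).symm (descentSet σ)).boundaries := by
      rw [descentComposition, ← Composition.toCompositionAsSet_boundaries]
      congr 1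
      exact (compositionEquiv n).apply_symm_apply _
    rw [this]
    simp only [compositionAsSetEquiv, Equiv.coe_fn_symm_mk, Finset.mem_filter, Finset.mem_univ,
      true_and, Set.mem_toFinset, Set.mem_ofPred_eq, Fin.ext_iff, Fin.val_zero, Fin.val_last,
      descentSet]
    refine or_congr Iff.rfl (or_congr Iff.rfl ?_)
    constructor
    · rintro ⟨i, hi, rfl⟩
      exact (succ_mem_descents (by omega)).2 (by simpa using hi)
    · rintro ⟨i, hi, rfl, h⟩
      exact ⟨⟨i, by omega⟩, by simpa using h, rfl⟩
  · refine iff_of_false (fun h => ?_) ?_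
    · have := le_sum_of_mem_cuts h
      rw [Composition.blocks_sum] at this
      omega
    · rintro (rfl | rfl | ⟨i, hi, rfl, -⟩) <;> omega

theorem zero_notMem_descents {α : Type*} [LinearOrder α] {n : ℕ} (w : Fin n → α) :
    0 ∉ descents w := by
  rintro ⟨i, -, h, -⟩
  omega

theorem lt_of_mem_descents {α : Type*} [LinearOrder α] {n : ℕ} {w : Fin n → α} {j : ℕ}
    (h : j ∈ descents w) : j < n := by
  obtain ⟨i, hi, rfl, -⟩ := h
  exact hi

theorem cuts_injective {n : ℕ} {α β : Composition n} (h : cuts α.blocks = cuts β.blocks) :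
    α = β := by
  apply boundaries_injective
  ext i
  rw [mem_boundaries_iff, mem_boundaries_iff, h]

theorem cuts_descentComposition_subset {n : ℕ} (σ : Equiv.Perm (Fin n)) {l : List ℕ}
    (hl : l.sum = n) : cuts (descentComposition σ).blocks ⊆ cuts l ↔ descents σ ⊆ cuts l := by
  constructor
  · intro h i hi
    exact h ((mem_cuts_descentComposition σ i).2 (Or.inr (Or.inr hi)))
  · intro h i hi
    rcases (mem_cuts_descentComposition σ i).1 hi with rfl | rfl | hi
    · exact zero_mem_cuts _
    · rw [← hl]; exact sum_mem_cuts _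
    · exact h hi

theorem descentComposition_eq_iff {n : ℕ} (σ τ : Equiv.Perm (Fin n)) :
    descentComposition σ = descentComposition τ ↔ descents σ = descents τ := by
  constructor
  · intro h
    ext j
    have := mem_cuts_descentComposition σ j
    rw [h, mem_cuts_descentComposition] at this
    have h0 := zero_notMem_descents σ
    have h0' := zero_notMem_descents τ
    by_cases hj : j = 0
    · subst hj; simp [h0, h0']
    · by_cases hn : j = n
      · exact iff_of_false (fun h => (lt_of_mem_descents h).ne hn)
          (fun h => (lt_of_mem_descents h).ne hn)
      · simpa [hj, hn] using this.symm
  · intro h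
    apply cuts_injective
    ext j
    rw [mem_cuts_descentComposition, mem_cuts_descentComposition, h]

/-! ### Fundamental functions indexed by sets of positions -/

open Classical in
/-- The sum of the `M_β` over the compositions `β` of `n` whose partial sums contain `T`. -/
noncomputable def fundamental (k : Type*) [Field k] (n : ℕ) (T : Set ℕ) : quasisymmetric k :=
  ∑ β : Composition n with T ⊆ cuts β.blocks, M k ⟨n, β⟩

theorem F_eq_fundamental (k : Type*) [Field k] {n : ℕ} (α : Composition n) :
    F k ⟨n, α⟩ = fundamental k n (cuts α.blocks) := by
  unfold F fundamental
  refine Finset.sum_congr ?_ fun _ _ => rfl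
  ext β
  simp only [Finset.mem_filter, Finset.mem_univ, true_and, refines_iff_cuts]

theorem F_descentComposition (k : Type*) [Field k] {n : ℕ} (σ : Equiv.Perm (Fin n)) :
    F k ⟨n, descentComposition σ⟩ = fundamental k n (descents σ) := by
  rw [F_eq_fundamental]
  unfold fundamental
  refine Finset.sum_congr ?_ fun _ _ => rfl
  ext β
  simp only [Finset.mem_filter, Finset.mem_univ, true_and,
    cuts_descentComposition_subset σ β.blocks_sum]

theorem fundamental_mem (k : Type*) [Field k] (n : ℕ) (T : Set ℕ) :
    fundamental k n T ∈ homogeneousPart k n :=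
  Submodule.sum_mem _ fun β _ => Submodule.subset_span ⟨β, rfl⟩

-- A monomial occurs in exactly one M_β, the one given by its exponent word, so at most one summand
-- contributes.
open Classical in
theorem coeff_fundamental (k : Type*) [Field k] (n : ℕ) (T : Set ℕ) (e : ℕ →₀ ℕ) :
    MvPowerSeries.coeff e (fundamental k n T : MvPowerSeries ℕ k)
      = if (exponentWord e).sum = n ∧ T ⊆ cuts (exponentWord e) then 1 else 0 := by
  unfold fundamental
  rw [AddSubmonoidClass.coe_finsetSum, map_sum]
  have : ∀ β : Composition n, MvPowerSeries.coeff e (M k ⟨n, β⟩ : MvPowerSeries ℕ k)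
      = if exponentWord e = β.blocks then 1 else 0 := fun β => coeff_monomialSeries k _ e
  simp only [this]
  split_ifs with h
  · obtain ⟨h1, h2⟩ := h
    let γ : Composition n := ⟨exponentWord e, pos_of_mem_exponentWord, h1⟩
    rw [Finset.sum_eq_single_of_mem γ (by simpa using h2)]
    · exact if_pos rfl
    · intro β _ hβ
      exact if_neg fun h => hβ (Composition.ext h.symm)
  · refine Finset.sum_eq_zero fun β hβ => if_neg fun he => h ?_
    rw [he]
    exact ⟨β.blocks_sum, by simpa using hβ⟩

theorem coeff_eq_zero_of_homogeneous {k : Type*} [Field k] {n : ℕ} {f : quasisymmetric k}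
    (hf : f ∈ homogeneousPart k n) {e : ℕ →₀ ℕ} (he : (exponentWord e).sum ≠ n) :
    MvPowerSeries.coeff e (f : MvPowerSeries ℕ k) = 0 := by
  induction hf using Submodule.span_induction with
  | mem x hx =>
    obtain ⟨β, rfl⟩ := hx
    refine (coeff_monomialSeries k _ e).trans (if_neg fun h => he ?_)
    rw [h]
    exact β.blocks_sum
  | zero => exact map_zero _
  | add y z _ _ hy hz => rw [Subalgebra.coe_add, map_add, hy, hz, add_zero]
  | smul c y _ hy => rw [Subalgebra.coe_smul, map_smul, hy, smul_zero]

/-! ### Partial sums of exponent words and weakly increasing words -/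

theorem exists_filter_lt_eq_take {L : List ℕ} (hL : L.SortedLT) (x : ℕ) :
    ∃ j, L.filter (· < x) = L.take j := by
  replace hL := hL.pairwise
  induction L with
  | nil => exact ⟨0, rfl⟩
  | cons a L ih =>
    rw [List.pairwise_cons] at hL
    by_cases ha : a < x
    · obtain ⟨j, hj⟩ := ih hL.2
      exact ⟨j + 1, by simp [ha, hj]⟩
    · refine ⟨0, ?_⟩
      rw [List.take_zero, List.filter_eq_nil_iff]
      intro b hb
      rcases List.mem_cons.1 hb with rfl | hb
      · simpa using ha
      · have := hL.1 b hb
        simp only [decide_eq_true_eq]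
        omega

theorem exists_take_eq_filter_lt {L : List ℕ} (hL : L.SortedLT) (j : ℕ) :
    ∃ x, L.take j = L.filter (· < x) := by
  replace hL := hL.pairwise
  induction L generalizing j with
  | nil => exact ⟨0, by simp⟩
  | cons a L ih =>
    rw [List.pairwise_cons] at hL
    cases j with
    | zero => exact ⟨0, by simp⟩
    | succ j =>
      obtain ⟨x, hx⟩ := ih j hL.2
      -- The threshold must exceed a to keep the head; later entries are at least a + 1, so raising
      -- x to a + 1 admits none of them.
      refine ⟨max x (a + 1), ?_⟩
      rw [List.take_succ_cons, List.filter_cons_of_pos (by simp), hx]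
      congr 1
      refine List.filter_congr fun b hb => ?_
      have := hL.1 b hb
      simp only [decide_eq_decide]
      omega

theorem sum_range_eq_sum_filter (e : ℕ →₀ ℕ) (x : ℕ) :
    ∑ y ∈ Finset.range x, e y = ((e.support.sort.filter (· < x)).map e).sum := by
  rw [← List.sum_toFinset _ ((Finset.sort_nodup _ _).filter _), List.toFinset_filter,
    Finset.sort_toFinset]
  symm
  apply Finset.sum_subset
  · intro y hy
    simpa using (Finset.mem_filter.1 hy).2
  · intro y hy hy'
    by_contra h
    exact hy' (Finset.mem_filter.2 ⟨Finsupp.mem_support_iff.2 h, by simpa using hy⟩)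

/-- Variables with exponent 0 add nothing, so partial sums over the support are the same as partial
sums over all variables below a threshold. -/
theorem mem_cuts_exponentWord {e : ℕ →₀ ℕ} {i : ℕ} :
    i ∈ cuts (exponentWord e) ↔ ∃ x, ∑ y ∈ Finset.range x, e y = i := by
  have hs : e.support.sort.SortedLT := Finset.sortedLT_sort _
  simp only [sum_range_eq_sum_filter]
  constructor
  · rintro ⟨j, rfl⟩
    obtain ⟨x, hx⟩ := exists_take_eq_filter_lt hs j
    exact ⟨x, by rw [← hx, exponentWord, List.map_take]⟩
  · rintro ⟨x, rfl⟩
    obtain ⟨j, hj⟩ := exists_filter_lt_eq_take hs x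
    exact ⟨j, by rw [hj, exponentWord, List.map_take]⟩

/-- The exponent vector of the monomial `x_{h(0)} ⋯ x_{h(n-1)}`. -/
noncomputable def content {n : ℕ} (h : Fin n → ℕ) : ℕ →₀ ℕ := ∑ i, Finsupp.single (h i) 1

theorem content_comp_perm {n : ℕ} (h : Fin n → ℕ) (τ : Equiv.Perm (Fin n)) :
    content (h ∘ τ) = content h :=
  Equiv.sum_comp τ fun i => Finsupp.single (h i) 1

theorem content_append {b c : ℕ} (h₁ : Fin b → ℕ) (h₂ : Fin c → ℕ) :
    content (Fin.append h₁ h₂) = content h₁ + content h₂ := by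
  simp [content, Fin.sum_univ_add]

theorem sum_range_content {n : ℕ} (h : Fin n → ℕ) (x : ℕ) :
    ∑ y ∈ Finset.range x, content h y = (Finset.univ.filter fun i => h i < x).card := by
  simp only [content, Finsupp.coe_finsetSum, Finset.sum_apply, Finsupp.single_apply]
  rw [Finset.sum_comm, Finset.card_filter]
  simp

theorem sum_exponentWord_content {n : ℕ} (h : Fin n → ℕ) : (exponentWord (content h)).sum = n := by
  rw [sum_exponentWord]
  change (content h).degree = n
  simp [content]

theorem apply_mem_support_content {n : ℕ} (h : Fin n → ℕ) (i : Fin n) :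
    h i ∈ (content h).support := by
  rw [Finsupp.mem_support_iff, content, Finsupp.coe_finsetSum, Finset.sum_apply]
  intro h0
  have := (Finset.sum_eq_zero_iff.1 h0) i (Finset.mem_univ _)
  simp at this

theorem exists_content_eq (n : ℕ) (e : ℕ →₀ ℕ) (he : e.degree = n) :
    ∃ h : Fin n → ℕ, content h = e := by
  induction n generalizing e with
  | zero =>
    refine ⟨Fin.elim0, ?_⟩
    rw [(Finsupp.degree_eq_zero_iff e).1 he]
    simp [content]
  | succ n ih =>
    obtain ⟨x, hx⟩ : ∃ x, e x ≠ 0 := by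
      by_contra! h
      have : e = 0 := Finsupp.ext h
      simp [this] at he
    have hle : Finsupp.single x 1 ≤ e := by
      rw [Finsupp.single_le_iff]
      omega
    have hadd : Finsupp.single x 1 + (e - Finsupp.single x 1) = e := add_tsub_cancel_of_le hle
    obtain ⟨h, hh⟩ := ih (e - Finsupp.single x 1) (by
      have := congrArg Finsupp.degree hadd
      rw [map_add, he, Finsupp.degree_single] at this
      omega)
    refine ⟨Fin.cons x h, ?_⟩
    rw [content, Fin.sum_univ_succ]
    simp only [Fin.cons_zero, Fin.cons_succ]
    rw [← hadd, ← hh]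
    rfl

theorem exists_monotone_content_eq {n : ℕ} {e : ℕ →₀ ℕ} (he : (exponentWord e).sum = n) :
    ∃ f : Fin n → ℕ, Monotone f ∧ content f = e := by
  obtain ⟨h, hh⟩ := exists_content_eq n e (by rw [← he, sum_exponentWord]; rfl)
  exact ⟨h ∘ Tuple.sort h, Tuple.monotone_sort h, by rw [content_comp_perm, hh]⟩

/-- In a weakly increasing word the letters below x form an initial segment, whose length is the
degree of the monomial in the variables below x. Thus the monomial determines the word. -/
theorem lt_iff_lt_sum_content {n : ℕ} {f : Fin n → ℕ} (hf : Monotone f) (i : Fin n)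
    (x : ℕ) : f i < x ↔ (i : ℕ) < ∑ y ∈ Finset.range x, content f y := by
  rw [sum_range_content]
  exact (Tuple.lt_card_lt_iff_apply_lt_of_monotone hf).symm

theorem eq_of_monotone_of_content_eq {n : ℕ} {f g : Fin n → ℕ} (hf : Monotone f) (hg : Monotone g)
    (h : content f = content g) : f = g := by
  funext i
  apply eq_of_forall_gt_iff
  intro x
  rw [lt_iff_lt_sum_content hf, lt_iff_lt_sum_content hg, h]

theorem succ_mem_cuts_content {n : ℕ} {f : Fin n → ℕ} (hf : Monotone f) {i : ℕ} (hi : i + 1 < n) :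
    i + 1 ∈ cuts (exponentWord (content f)) ↔ f ⟨i, by omega⟩ < f ⟨i + 1, hi⟩ := by
  rw [mem_cuts_exponentWord]
  constructor
  · rintro ⟨x, hx⟩
    have h1 := lt_iff_lt_sum_content hf ⟨i, by omega⟩ x
    have h2 := lt_iff_lt_sum_content hf ⟨i + 1, hi⟩ x
    rw [hx] at h1 h2
    simp only [lt_add_iff_pos_right, zero_lt_one, iff_true, lt_self_iff_false, iff_false] at h1 h2
    omega
  · intro h
    refine ⟨f ⟨i + 1, hi⟩, ?_⟩
    have h1 := lt_iff_lt_sum_content hf ⟨i, by omega⟩ (f ⟨i + 1, hi⟩)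
    have h2 := lt_iff_lt_sum_content hf ⟨i + 1, hi⟩ (f ⟨i + 1, hi⟩)
    simp only [h, lt_self_iff_false, true_iff, false_iff] at h1 h2
    omega

/-! ### Standardization and the counting of compatible words -/

/-- This is standardization: replace each letter by its rank. The rank permutation is the inverse of
the one that sorts the word. -/
theorem exists_perm_lt_iff {α : Type*} [LinearOrder α] {n : ℕ} {g : Fin n → α}
    (hg : Function.Injective g) : ∃ τ : Equiv.Perm (Fin n), ∀ i j, τ i < τ j ↔ g i < g j := by
  have hs : StrictMono (g ∘ Tuple.sort g) :=
    (Tuple.monotone_sort g).strictMono_of_injective (hg.comp (Tuple.sort g).injective)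
  refine ⟨(Tuple.sort g)⁻¹, fun i j => ?_⟩
  rw [← hs.lt_iff_lt]
  simp

theorem perm_eq_of_lt_iff {n : ℕ} {σ τ : Equiv.Perm (Fin n)}
    (h : ∀ i j, σ i < σ j ↔ τ i < τ j) : σ = τ := by
  have hm : Monotone (σ * τ⁻¹ : Equiv.Perm (Fin n)) := by
    have : StrictMono (σ * τ⁻¹ : Equiv.Perm (Fin n)) := by
      intro i j hij
      simp only [Equiv.Perm.coe_mul, Function.comp_apply, h]
      simpa using hij
    exact this.monotone
  rw [Equiv.Perm.monotone_iff] at hm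
  exact mul_inv_eq_one.1 hm

theorem strictMono_of_lt_succ {α : Type*} [Preorder α] {n : ℕ} {g : Fin n → α}
    (h : ∀ (i : ℕ) (hi : i + 1 < n), g ⟨i, by omega⟩ < g ⟨i + 1, hi⟩) : StrictMono g := by
  cases n with
  | zero => exact fun i => i.elim0
  | succ n =>
    rw [Fin.strictMono_iff_lt_succ]
    exact fun i => h i (by omega)

/-- The words `h` with content `e` such that the descents of the pairs `(h, w)`, compared
lexicographically, lie in `S`. -/
abbrev CompatibleWord {α : Type*} [LinearOrder α] {n : ℕ} (w : Fin n → α) (S : Set ℕ)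
    (e : ℕ →₀ ℕ) : Type :=
  {h : Fin n → ℕ // content h = e ∧ descents (fun i => toLex (h i, w i)) ⊆ S}

instance {α : Type*} [LinearOrder α] {n : ℕ} (w : Fin n → α) (S : Set ℕ) (e : ℕ →₀ ℕ) :
    Finite (CompatibleWord w S e) := by
  have : {h : Fin n → ℕ | content h = e ∧ descents (fun i => toLex (h i, w i)) ⊆ S}.Finite := by
    refine (Set.Finite.pi' fun _ : Fin n => e.support.finite_toSet).subset ?_
    rintro h ⟨rfl, -⟩ i
    exact apply_mem_support_content h i
  exact this.to_subtype

/-- At a permitted cut b nothing relates the last letter of the first half to the first letter of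
the second, so the halves are chosen independently and their contents add. This is the Cauchy
product of power series in disguise. -/
theorem card_compatibleWord_add {α : Type*} [LinearOrder α] {b c : ℕ} (w : Fin (b + c) → α)
    {S : Set ℕ} (hb : b ∈ S) (e : ℕ →₀ ℕ) :
    Nat.card (CompatibleWord w S e) = ∑ p ∈ Finset.HasAntidiagonal.antidiagonal e,
      Nat.card (CompatibleWord (fun i => w (Fin.castAdd c i)) S p.1) *
        Nat.card (CompatibleWord (fun i => w (Fin.natAdd b i)) {j | b + j ∈ S} p.2) := by
  simp only [← Nat.card_prod]
  rw [← Finset.sum_coe_sort (Finset.HasAntidiagonal.antidiagonal e) fun p =>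
    Nat.card (CompatibleWord (fun i => w (Fin.castAdd c i)) S p.1 ×
      CompatibleWord (fun i => w (Fin.natAdd b i)) {j | b + j ∈ S} p.2), ← Nat.card_sigma]
  symm
  refine Nat.card_eq_of_bijective (fun q => ⟨Fin.append q.2.1.1 q.2.2.1, ?_, ?_⟩) ⟨?_, ?_⟩
  · rw [content_append, q.2.1.2.1, q.2.2.2.1]
    exact Finset.HasAntidiagonal.mem_antidiagonal.1 q.1.2
  · rw [descents_subset_add_iff hb]
    simp only [Fin.append_left, Fin.append_right]
    exact ⟨q.2.1.2.2, q.2.2.2.2⟩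
  · rintro ⟨⟨⟨p₁, p₂⟩, hp⟩, ⟨h₁, c₁, d₁⟩, ⟨h₂, c₂, d₂⟩⟩ ⟨⟨⟨p₁', p₂'⟩, hp'⟩, ⟨h₁', c₁', d₁'⟩, ⟨h₂', c₂', d₂'⟩⟩ h
    have h' : Fin.append h₁ h₂ = Fin.append h₁' h₂' := congrArg Subtype.val h
    obtain rfl : h₁ = h₁' := by
      funext i
      simpa using congrFun h' (Fin.castAdd c i)
    obtain rfl : h₂ = h₂' := by
      funext i
      simpa using congrFun h' (Fin.natAdd b i)
    dsimp only at c₁ c₂ c₁' c₂'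
    subst c₁ c₂ c₁' c₂'
    rfl
  · rintro ⟨h, rfl, hd⟩
    rw [descents_subset_add_iff hb] at hd
    refine ⟨⟨⟨(content fun i => h (Fin.castAdd c i), content fun i => h (Fin.natAdd b i)), ?_⟩,
      ⟨_, rfl, hd.1⟩, ⟨_, rfl, hd.2⟩⟩, ?_⟩
    · rw [Finset.HasAntidiagonal.mem_antidiagonal, ← content_append, Fin.append_castAdd_natAdd]
    · exact Subtype.ext Fin.append_castAdd_natAdd

/-- Let f be the weakly increasing word with content e. A word h corresponds to the standardization
τ of the pairs (h i, w i), and h = f ∘ τ recovers it. Descents of τ are those of the pairs. That the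
pairs sort correctly means that w ∘ τ⁻¹ increases along ties of f, hence descends only at partial
sums of the exponents. -/
theorem card_compatibleWord {α : Type*} [LinearOrder α] {n : ℕ} {w : Fin n → α}
    (hw : Function.Injective w) (S : Set ℕ) {e : ℕ →₀ ℕ} (he : (exponentWord e).sum = n) :
    Nat.card (CompatibleWord w S e) =
      Nat.card {τ : Equiv.Perm (Fin n) //
        descents τ ⊆ S ∧ descents (fun i => w (τ⁻¹ i)) ⊆ cuts (exponentWord e)} := by
  obtain ⟨f, hf, rfl⟩ := exists_monotone_content_eq he
  -- Read in the order τ⁻¹, the pairs increase strictly: either f does, or f is tied and a descent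
  -- of w ∘ τ⁻¹ is excluded there.
  have key : ∀ τ : Equiv.Perm (Fin n),
      descents (fun i => w (τ⁻¹ i)) ⊆ cuts (exponentWord (content f)) →
      ∀ i j, toLex (f (τ i), w i) < toLex (f (τ j), w j) ↔ τ i < τ j := by
    intro τ hτ i j
    have hs : StrictMono fun i => toLex (f i, w (τ⁻¹ i)) := by
      apply strictMono_of_lt_succ
      intro i hi
      rw [Prod.Lex.toLex_lt_toLex]
      rcases (hf (show (⟨i, by omega⟩ : Fin n) ≤ ⟨i + 1, hi⟩ from Nat.le_succ i)).lt_or_eq with h | h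
      · exact Or.inl h
      · refine Or.inr ⟨h, ?_⟩
        by_contra hlt
        have hne : w (τ⁻¹ ⟨i, by omega⟩) ≠ w (τ⁻¹ ⟨i + 1, hi⟩) := by
          intro h
          have := τ⁻¹.injective (hw h)
          simp at this
        have hmem := hτ ((succ_mem_descents hi).2 (lt_of_le_of_ne (not_lt.1 hlt) hne.symm))
        exact ((succ_mem_cuts_content hf hi).1 hmem).ne h
    have := hs.lt_iff_lt (a := τ i) (b := τ j)
    simpa using this
  symm
  refine Nat.card_eq_of_bijective (fun τ => ⟨f ∘ τ.1, content_comp_perm f τ.1, ?_⟩) ⟨?_, ?_⟩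
  · exact (descents_congr (key τ.1 τ.2.2)).trans_subset τ.2.1
  · rintro ⟨σ, hσ⟩ ⟨τ, hτ⟩ h
    have h' : ∀ i, f (σ i) = f (τ i) := congrFun (congrArg Subtype.val h)
    apply Subtype.ext
    refine perm_eq_of_lt_iff fun i j => ?_
    rw [← key σ hσ.2, ← key τ hτ.2, h', h']
  · rintro ⟨h, hc, hd⟩
    have hinj : Function.Injective fun i => toLex (h i, w i) := fun i j hij =>
      hw (Prod.mk.inj (toLex.injective hij)).2
    obtain ⟨τ, hτ⟩ := exists_perm_lt_iff hinj
    have hs : StrictMono fun i => toLex (h (τ⁻¹ i), w (τ⁻¹ i)) := by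
      intro i j hij
      apply (hτ _ _).1
      simpa using hij
    have hm : Monotone (h ∘ (τ⁻¹ : Equiv.Perm (Fin n))) := by
      intro i j hij
      have := hs.monotone hij
      rw [Prod.Lex.toLex_le_toLex] at this
      rcases this with h | h
      · exact h.le
      · exact h.1.le
    have hfh : h ∘ (τ⁻¹ : Equiv.Perm (Fin n)) = f :=
      eq_of_monotone_of_content_eq hm hf (by rw [content_comp_perm, hc])
    refine ⟨⟨τ, ?_, ?_⟩, Subtype.ext ?_⟩
    · rw [descents_congr hτ]
      exact hd
    · rw [descents_subset_iff]
      intro i hi hlt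
      rw [succ_mem_cuts_content hf hi, ← hfh]
      have := hs (show (⟨i, by omega⟩ : Fin n) < ⟨i + 1, hi⟩ from Nat.lt_succ_self i)
      rw [Prod.Lex.toLex_lt_toLex] at this
      exact this.resolve_right fun h => lt_asymm h.2 hlt
    · funext i
      simp [← hfh]

/-! ### Products of fundamental functions as sums over shuffles -/

open Classical in
/-- The sum of the fundamental quasisymmetric functions of the words `w ∘ τ⁻¹`, over the
permutations `τ` whose descents lie in `S`: the sum over the shuffles of the pieces into which
`S` cuts the word `w`. -/
noncomputable def shuffleSum (k : Type*) [Field k] {α : Type*} [LinearOrder α] {n : ℕ}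
    (w : Fin n → α) (S : Set ℕ) : quasisymmetric k :=
  ∑ τ ∈ Finset.univ.filter fun τ : Equiv.Perm (Fin n) => descents τ ⊆ S,
    fundamental k n (descents fun i => w (τ⁻¹ i))

theorem shuffleSum_mem (k : Type*) [Field k] {α : Type*} [LinearOrder α] {n : ℕ}
    (w : Fin n → α) (S : Set ℕ) : shuffleSum k w S ∈ homogeneousPart k n :=
  Submodule.sum_mem _ fun _ _ => fundamental_mem k n _

theorem coeff_shuffleSum (k : Type*) [Field k] {α : Type*} [LinearOrder α] {n : ℕ}
    {w : Fin n → α} (hw : Function.Injective w) (S : Set ℕ) (e : ℕ →₀ ℕ) :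
    MvPowerSeries.coeff e (shuffleSum k w S : MvPowerSeries ℕ k)
      = (Nat.card (CompatibleWord w S e) : k) := by
  classical
  by_cases he : (exponentWord e).sum = n
  · rw [card_compatibleWord hw S he, shuffleSum, AddSubmonoidClass.coe_finsetSum, map_sum]
    simp only [coeff_fundamental, he, true_and]
    rw [Finset.sum_boole, Finset.filter_filter, Nat.card_eq_fintype_card, Fintype.card_subtype]
  · rw [coeff_eq_zero_of_homogeneous (shuffleSum_mem k w S) he]
    have : IsEmpty (CompatibleWord w S e) :=
      ⟨fun h => he (by rw [← h.2.1, sum_exponentWord_content])⟩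
    simp

/-- The product rule for fundamental functions, iterated over the cuts. Both sides count compatible
words in each coefficient, and those counts multiply across a cut. -/
theorem shuffleSum_add (k : Type*) [Field k] {α : Type*} [LinearOrder α] {b c : ℕ}
    {w : Fin (b + c) → α} (hw : Function.Injective w) {S : Set ℕ} (hb : b ∈ S) :
    shuffleSum k w S = shuffleSum k (fun i => w (Fin.castAdd c i)) S *
      shuffleSum k (fun i => w (Fin.natAdd b i)) {j | b + j ∈ S} := by
  apply Subtype.ext
  ext e
  rw [Subalgebra.coe_mul, MvPowerSeries.coeff_mul, coeff_shuffleSum k hw,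
    card_compatibleWord_add w hb, Nat.cast_sum]
  refine Finset.sum_congr rfl fun p _ => ?_
  rw [Nat.cast_mul]
  exact congrArg₂ _ (coeff_shuffleSum k (hw.comp (Fin.castAdd_injective b c)) _ _).symm
    (coeff_shuffleSum k (hw.comp (Fin.natAdd_injective c b)) _ _).symm

/-- Without interior cuts the word is a single piece: a permutation with no descents is the
identity. -/
theorem shuffleSum_of_no_cuts (k : Type*) [Field k] {α : Type*} [LinearOrder α] {n : ℕ}
    (w : Fin n → α) {S : Set ℕ} (hS : ∀ i ∈ S, i = 0 ∨ n ≤ i) :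
    shuffleSum k w S = fundamental k n (descents w) := by
  classical
  unfold shuffleSum
  have : (Finset.univ.filter fun τ : Equiv.Perm (Fin n) => descents ⇑τ ⊆ S) = {1} := by
    ext τ
    simp only [Finset.mem_filter, Finset.mem_univ, true_and, Finset.mem_singleton]
    constructor
    · intro h
      rw [← Equiv.Perm.monotone_iff]
      refine (strictMono_of_lt_succ fun i hi => ?_).monotone
      by_contra hlt
      have hne : τ ⟨i, by omega⟩ ≠ τ ⟨i + 1, hi⟩ := by simp
      have := hS _ (h ((succ_mem_descents hi).2 (lt_of_le_of_ne (not_lt.1 hlt) hne.symm)))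
      omega
    · rintro rfl
      rw [descents_subset_iff]
      intro i hi hlt
      simp only [Equiv.Perm.coe_one, id_eq, Fin.mk_lt_mk] at hlt
      omega
  rw [this, Finset.sum_singleton]
  simp

/-! ### Coordinates in the monomial and fundamental bases -/

section Coordinates

variable {k : Type*} [Field k]

theorem monomialBasis_apply (α : Σ n : ℕ, Composition n) : monomialBasis k α = M k α := by
  rw [monomialBasis, Module.Basis.mk_apply]

theorem fundamentalBasis_apply (α : Σ n : ℕ, Composition n) : fundamentalBasis k α = F k α := by
  rw [fundamentalBasis, Module.Basis.mk_apply]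

open Classical in
theorem coord_M (α β : Σ n : ℕ, Composition n) :
    (monomialBasis k).coord β (M k α) = if α = β then 1 else 0 := by
  rw [← monomialBasis_apply, Module.Basis.coord_apply, Module.Basis.repr_self,
    Finsupp.single_apply]

theorem coord_eq_zero {n : ℕ} {f : quasisymmetric k} (hf : f ∈ homogeneousPart k n)
    {β : Σ n : ℕ, Composition n} (hβ : β.1 ≠ n) : (monomialBasis k).coord β f = 0 := by
  induction hf using Submodule.span_induction with
  | mem x hx =>
    obtain ⟨γ, rfl⟩ := hx
    rw [coord_M, if_neg]
    rintro rfl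
    exact hβ rfl
  | zero => exact map_zero _
  | add y z _ _ hy hz => rw [map_add, hy, hz, add_zero]
  | smul c y _ hy => rw [map_smul, hy, smul_zero]

open Classical in
theorem coord_fundamental {n : ℕ} (T : Set ℕ) (β : Composition n) :
    (monomialBasis k).coord ⟨n, β⟩ (fundamental k n T) = if T ⊆ cuts β.blocks then 1 else 0 := by
  unfold fundamental
  rw [map_sum]
  simp only [coord_M, Sigma.mk.injEq, heq_eq_eq, true_and]
  rw [Finset.sum_ite_eq']
  simp

theorem comul_M (α : Σ n : ℕ, Composition n) :
    CoalgebraStruct.comul (R := k) (M k α) =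
      ∑ i ∈ Finset.range (α.2.length + 1), M k (takeParts α i) ⊗ₜ[k] M k (dropParts α i) := by
  rw [← monomialBasis_apply]
  exact (monomialBasis k).constr_basis k _ α

/-- Concatenation of compositions is dual to the coproduct. -/
theorem coord_append {b c : ℕ} (γ : Composition b) (δ : Composition c) (f : quasisymmetric k) :
    (monomialBasis k).coord ⟨b + c, γ.append δ⟩ f =
      LinearMap.mul' k k (TensorProduct.map ((monomialBasis k).coord ⟨b, γ⟩)
        ((monomialBasis k).coord ⟨c, δ⟩) (CoalgebraStruct.comul (R := k) f)) := by
  classical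
  suffices h : (monomialBasis k).coord ⟨b + c, γ.append δ⟩ =
      LinearMap.mul' k k ∘ₗ TensorProduct.map ((monomialBasis k).coord ⟨b, γ⟩)
        ((monomialBasis k).coord ⟨c, δ⟩) ∘ₗ CoalgebraStruct.comul (R := k) from
    DFunLike.congr_fun h f
  refine (monomialBasis k).ext fun α => ?_
  rw [monomialBasis_apply, LinearMap.comp_apply, LinearMap.comp_apply, comul_M, map_sum, map_sum]
  simp only [TensorProduct.map_tmul, LinearMap.mul'_apply, coord_M]
  simp only [Composition.sigma_eq_iff_blocks_eq, takeParts, dropParts, Composition.append_blocks]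
  split_ifs with h
  -- Only the deconcatenation after as many parts as γ has can produce γ on the left.
  · rw [Finset.sum_eq_single γ.blocks.length]
    · simp [h]
    · intro i hi hne
      rw [if_neg, zero_mul]
      intro h'
      apply hne
      rw [← h', List.length_take]
      simp only [Finset.mem_range, Composition.length] at hi
      omega
    · intro h'
      simp only [Finset.mem_range, Composition.length, h, List.length_append] at h'
      omega
  · symm
    refine Finset.sum_eq_zero fun i _ => ?_
    split_ifs with h1 h2
    · rw [← h1, ← h2, List.take_append_drop] at h
      exact absurd rfl h
    all_goals simp

theorem coord_append_map (Φ : quasisymmetric k →ₐc[k] quasisymmetric k) {b c : ℕ}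
    (γ : Composition b) (δ : Composition c) (f : quasisymmetric k) :
    (monomialBasis k).coord ⟨b + c, γ.append δ⟩ (Φ f) =
      LinearMap.mul' k k (TensorProduct.map
        ((monomialBasis k).coord ⟨b, γ⟩ ∘ₗ (Φ : quasisymmetric k →ₗ[k] quasisymmetric k))
        ((monomialBasis k).coord ⟨c, δ⟩ ∘ₗ (Φ : quasisymmetric k →ₗ[k] quasisymmetric k))
          (CoalgebraStruct.comul (R := k) f)) := by
  rw [coord_append, ← CoalgHomClass.map_comp_comul_apply, TensorProduct.map_comp]
  rfl

theorem exponentWord_single (n : ℕ) :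
    exponentWord (Finsupp.single 0 n : ℕ →₀ ℕ) = (onePart n).blocks := by
  unfold exponentWord onePart
  split_ifs with h
  · rw [Finsupp.support_single _ h.ne']
    simp
  · obtain rfl : n = 0 := by omega
    simp

theorem coord_onePart (n : ℕ) (f : quasisymmetric k) :
    (monomialBasis k).coord ⟨n, onePart n⟩ f =
      MvPowerSeries.coeff (Finsupp.single 0 n) (f : MvPowerSeries ℕ k) := by
  classical
  suffices h : (monomialBasis k).coord ⟨n, onePart n⟩ =
      MvPowerSeries.coeff (Finsupp.single 0 n) ∘ₗ (quasisymmetric k).val.toLinearMap from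
    DFunLike.congr_fun h f
  refine (monomialBasis k).ext fun α => ?_
  rw [monomialBasis_apply, coord_M]
  refine Eq.trans ?_ (coeff_monomialSeries k α _).symm
  rw [exponentWord_single]
  exact if_congr (Composition.sigma_eq_iff_blocks_eq.trans eq_comm) rfl rfl

/-- Setting every variable except x₀ to zero is multiplicative, and homogeneity leaves only the pair
of exponents (a, b) in the product. -/
theorem coord_onePart_mul {a b : ℕ} {f g : quasisymmetric k} (hf : f ∈ homogeneousPart k a)
    (hg : g ∈ homogeneousPart k b) :
    (monomialBasis k).coord ⟨a + b, onePart (a + b)⟩ (f * g) =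
      (monomialBasis k).coord ⟨a, onePart a⟩ f * (monomialBasis k).coord ⟨b, onePart b⟩ g := by
  simp only [coord_onePart]
  rw [Subalgebra.coe_mul, MvPowerSeries.coeff_mul]
  refine Finset.sum_eq_single_of_mem (Finsupp.single 0 a, Finsupp.single 0 b) ?_ ?_
  · rw [Finset.HasAntidiagonal.mem_antidiagonal, ← Finsupp.single_add]
  · rintro ⟨p, q⟩ hpq hne
    rw [Finset.HasAntidiagonal.mem_antidiagonal] at hpq
    dsimp only at hpq ⊢
    have hzero : ∀ i, i ≠ 0 → p i = 0 ∧ q i = 0 := by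
      intro i hi
      have := DFunLike.congr_fun hpq i
      rw [Finsupp.add_apply, Finsupp.single_eq_of_ne hi] at this
      omega
    have hp : p = Finsupp.single 0 (p 0) := by
      ext i
      by_cases hi : i = 0
      · simp [hi]
      · rw [Finsupp.single_eq_of_ne hi, (hzero i hi).1]
    have hq : q = Finsupp.single 0 (q 0) := by
      ext i
      by_cases hi : i = 0
      · simp [hi]
      · rw [Finsupp.single_eq_of_ne hi, (hzero i hi).2]
    have hdeg : ∀ m, (exponentWord (Finsupp.single 0 m : ℕ →₀ ℕ)).sum = m := fun m => by
      rw [exponentWord_single, Composition.blocks_sum]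
    by_cases hpa : p 0 = a
    · have hqb : q 0 ≠ b := by
        rintro rfl
        subst hpa
        exact hne (Prod.ext hp hq)
      rw [coeff_eq_zero_of_homogeneous hg, mul_zero]
      rwa [hq, hdeg]
    · rw [coeff_eq_zero_of_homogeneous hf, zero_mul]
      rwa [hp, hdeg]

theorem cuts_onePart_subset {n : ℕ} (α : Composition n) :
    cuts (onePart n).blocks ⊆ cuts α.blocks := by
  rintro _ ⟨j, rfl⟩
  unfold onePart
  split_ifs with h
  · cases j with
    | zero => exact zero_mem_cuts _
    | succ j =>
      have := sum_mem_cuts α.blocks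
      rw [α.blocks_sum] at this
      simpa using this
  · simpa using zero_mem_cuts _

/-- The composition (n) is the coarsest one, so it refines only itself. -/
theorem coord_onePart_F {n : ℕ} (α : Composition n) :
    (monomialBasis k).coord ⟨n, onePart n⟩ (F k ⟨n, α⟩) = if α = onePart n then 1 else 0 := by
  classical
  rw [F_eq_fundamental, coord_fundamental]
  refine if_congr ⟨fun h => cuts_injective (h.antisymm (cuts_onePart_subset α)), ?_⟩ rfl rfl
  rintro rfl
  exact subset_rfl

/-- A homogeneous quasisymmetric function is a combination of fundamental functions of its
degree. -/
theorem eq_sum_repr_F {n : ℕ} {f : quasisymmetric k} (hf : f ∈ homogeneousPart k n) :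
    f = ∑ β : Composition n, (fundamentalBasis k).coord ⟨n, β⟩ f • F k ⟨n, β⟩ := by
  classical
  -- P and Q are the projections to degree n written in the two bases. They agree on every F_γ: both
  -- fix it in degree n and kill it in other degrees.
  let P : quasisymmetric k →ₗ[k] quasisymmetric k :=
    ∑ β : Composition n, ((monomialBasis k).coord ⟨n, β⟩).smulRight (M k ⟨n, β⟩)
  let Q : quasisymmetric k →ₗ[k] quasisymmetric k :=
    ∑ β : Composition n, ((fundamentalBasis k).coord ⟨n, β⟩).smulRight (F k ⟨n, β⟩)
  have hPM : ∀ β : Composition n, P (M k ⟨n, β⟩) = M k ⟨n, β⟩ := by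
    intro β
    simp only [P, LinearMap.sum_apply, LinearMap.smulRight_apply, coord_M, Sigma.mk.injEq,
      heq_eq_eq, true_and, ite_smul, one_smul, zero_smul]
    simp
  have hP : ∀ g ∈ homogeneousPart k n, P g = g := by
    intro g hg
    induction hg using Submodule.span_induction with
    | mem x hx =>
      obtain ⟨β, rfl⟩ := hx
      exact hPM β
    | zero => exact map_zero _
    | add y z _ _ hy hz => rw [map_add, hy, hz]
    | smul c y _ hy => rw [map_smul, hy]
  have hPQ : P = Q := by
    refine (fundamentalBasis k).ext ?_
    rintro ⟨m, γ⟩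
    simp only [Q, LinearMap.sum_apply, LinearMap.smulRight_apply, Module.Basis.coord_apply,
      Module.Basis.repr_self, Finsupp.single_apply]
    by_cases hm : m = n
    · subst hm
      rw [fundamentalBasis_apply, hP _ (by rw [F_eq_fundamental]; exact fundamental_mem k m _)]
      simp
    · have hne : ∀ β : Composition n, (⟨m, γ⟩ : Σ n, Composition n) ≠ ⟨n, β⟩ :=
        fun β h => hm (congrArg Sigma.fst h)
      simp only [hne, if_false, zero_smul, Finset.sum_const_zero, P, LinearMap.sum_apply,
        LinearMap.smulRight_apply]
      refine Finset.sum_eq_zero fun β _ => ?_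
      rw [fundamentalBasis_apply, F_eq_fundamental,
        coord_eq_zero (fundamental_mem k m _) (Ne.symm hm), zero_smul]
  calc f = P f := (hP f hf).symm
    _ = Q f := by rw [hPQ]
    _ = _ := by simp [Q]

end Coordinates

/-! ### The action of a graded Hopf endomorphism on fundamental functions -/

section Endomorphism

variable {k : Type*} [Field k] {Φ : quasisymmetric k →ₐc[k] quasisymmetric k}

-- Deconcatenating the M_β that make up the fundamental function of w, gradedness kills every cut
-- not at the partial sum b. For β = β₁ · β₂ cut at b, the condition on descents of w separates into
-- conditions on the two halves, so the double sum factors.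
open Classical in
theorem coord_append_map_fundamental (hΦ : IsGraded Φ) {b c : ℕ} (γ : Composition b)
    (δ : Composition c) {α : Type*} [LinearOrder α] (w : Fin (b + c) → α) :
    (monomialBasis k).coord ⟨b + c, γ.append δ⟩ (Φ (fundamental k (b + c) (descents w))) =
      (monomialBasis k).coord ⟨b, γ⟩
        (Φ (fundamental k b (descents fun i => w (Fin.castAdd c i)))) *
      (monomialBasis k).coord ⟨c, δ⟩
        (Φ (fundamental k c (descents fun i => w (Fin.natAdd b i)))) := by
  have hM : ∀ {m : ℕ} (ε : Composition m) (x : Σ n, Composition n), x.1 ≠ m →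
      (monomialBasis k).coord ⟨m, ε⟩ (Φ (M k x)) = 0 := fun ε x hx =>
    coord_eq_zero (hΦ x.1 _ (Submodule.subset_span ⟨x.2, rfl⟩)) (Ne.symm hx)
  have hdesc : ∀ (β₁ : Composition b) (β₂ : Composition c),
      descents w ⊆ cuts (β₁.append β₂).blocks ↔
        descents (fun i => w (Fin.castAdd c i)) ⊆ cuts β₁.blocks ∧
        descents (fun i => w (Fin.natAdd b i)) ⊆ cuts β₂.blocks := by
    intro β₁ β₂
    have hb : b ∈ cuts (β₁.append β₂).blocks := by
      have := (add_mem_cuts_append (l₁ := β₁.blocks) (l₂ := β₂.blocks) (j := 0)).2 (zero_mem_cuts _)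
      simpa using this
    rw [descents_subset_add_iff hb]
    refine and_congr ?_ ?_
    · refine forall₂_congr fun i hi => ?_
      refine mem_cuts_append_lt ?_
      rw [β₁.blocks_sum]
      exact lt_of_mem_descents hi
    · refine forall₂_congr fun i _ => ?_
      have := add_mem_cuts_append (l₁ := β₁.blocks) (l₂ := β₂.blocks) (j := i)
      rwa [β₁.blocks_sum] at this
  unfold fundamental
  rw [coord_append_map]
  simp only [map_sum, comul_M, TensorProduct.map_tmul, LinearMap.mul'_apply, LinearMap.comp_apply]
  rw [Finset.sum_mul_sum, ← Finset.sum_product', Finset.sum_sigma']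
  symm
  refine Finset.sum_of_injOn
    (fun q => (⟨q.1.append q.2, q.1.length⟩ : Σ _ : Composition (b + c), ℕ)) ?_ ?_ ?_ ?_
  · rintro ⟨β₁, β₂⟩ - ⟨β₁', β₂'⟩ - h
    simp only [Sigma.mk.injEq, heq_eq_eq] at h
    have h' := congrArg Composition.blocks h.1
    simp only [Composition.append_blocks] at h'
    have := List.append_inj h' h.2
    exact Prod.ext (Composition.ext this.1) (Composition.ext this.2)
  · rintro ⟨β₁, β₂⟩ h
    simp only [Finset.coe_product, Finset.coe_filter, Finset.mem_univ, true_and, Set.mem_prod,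
      Set.mem_ofPred_eq] at h
    simp only [Finset.coe_sigma, Set.mem_sigma_iff, Finset.coe_filter, Finset.mem_univ, true_and,
      Set.mem_ofPred_eq, Finset.coe_range, Set.mem_Iio]
    refine ⟨(hdesc _ _).2 h, ?_⟩
    simp only [Composition.length, Composition.append_blocks, List.length_append]
    omega
  · rintro ⟨β, i⟩ hβ hne
    simp only [Finset.mem_sigma, Finset.mem_filter, Finset.mem_univ, true_and,
      Finset.mem_range] at hβ
    by_cases h1 : (β.blocks.take i).sum = b
    · exfalso
      have hsum : (β.blocks.take i).sum + (β.blocks.drop i).sum = b + c := by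
        rw [← List.sum_append, List.take_append_drop, β.blocks_sum]
      let β₁ : Composition b := ⟨β.blocks.take i, fun h => β.blocks_pos (List.mem_of_mem_take h), h1⟩
      let β₂ : Composition c :=
        ⟨β.blocks.drop i, fun h => β.blocks_pos (List.mem_of_mem_drop h), by omega⟩
      have happ : β₁.append β₂ = β := Composition.ext (List.take_append_drop i β.blocks)
      refine hne ⟨(β₁, β₂), ?_, ?_⟩
      · simp only [Finset.coe_product, Finset.coe_filter, Finset.mem_univ, true_and, Set.mem_prod,
          Set.mem_ofPred_eq]
        rw [← hdesc, happ]
        exact hβ.1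
      · refine Sigma.ext happ (heq_of_eq ?_)
        have := hβ.2
        simp only [Composition.length, β₁, List.length_take] at this ⊢
        omega
    · exact mul_eq_zero_of_left (hM γ (takeParts ⟨b + c, β⟩ i) h1) _
  · rintro ⟨β₁, β₂⟩ -
    have e1 : takeParts ⟨b + c, β₁.append β₂⟩ β₁.length = ⟨b, β₁⟩ := by
      rw [Composition.sigma_eq_iff_blocks_eq]
      simp [takeParts, Composition.length]
    have e2 : dropParts ⟨b + c, β₁.append β₂⟩ β₁.length = ⟨c, β₂⟩ := by
      rw [Composition.sigma_eq_iff_blocks_eq]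
      simp [dropParts, Composition.length]
    dsimp only
    rw [e1, e2]
    rfl

/-- Induction on the parts of β. Each step splits off the first part on the left by the coproduct
and on the right by the product. Words over any linear order are allowed, so that the induction
applies to the remaining subword. -/
theorem coord_map_fundamental (hΦ : IsGraded Φ) {α : Type*} [LinearOrder α] {n : ℕ}
    (β : Composition n) {w : Fin n → α} (hw : Function.Injective w) :
    (monomialBasis k).coord ⟨n, β⟩ (Φ (fundamental k n (descents w))) =
      (monomialBasis k).coord ⟨n, onePart n⟩ (Φ (shuffleSum k w (cuts β.blocks))) := by
  induction β using Composition.recOnSingleAppend with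
  | zero =>
    rw [shuffleSum_of_no_cuts k w fun i _ => Or.inr (Nat.zero_le i)]
    congr 2
  | single_append m n c ih =>
    have hone : Composition.single (m + 1) m.succ_pos = onePart (m + 1) := by
      rw [onePart, dif_pos m.succ_pos]
    have hcut : m + 1 ∈ cuts ((Composition.single (m + 1) m.succ_pos).append c).blocks := by
      have := (add_mem_cuts_append (l₁ := [m + 1]) (l₂ := c.blocks) (j := 0)).2 (zero_mem_cuts _)
      simpa using this
    have hset : {j | m + 1 + j ∈ cuts ((Composition.single (m + 1) m.succ_pos).append c).blocks} =
        cuts c.blocks := by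
      ext j
      simpa using add_mem_cuts_append (l₁ := [m + 1]) (l₂ := c.blocks) (j := j)
    have hright : Function.Injective fun i => w (Fin.natAdd (m + 1) i) :=
      hw.comp (Fin.natAdd_injective _ _)
    rw [coord_append_map_fundamental hΦ, ih hright,
      shuffleSum_add k hw hcut, hset, map_mul,
      coord_onePart_mul (hΦ _ _ (shuffleSum_mem k _ _)) (hΦ _ _ (shuffleSum_mem k _ _)), hone]
    congr 3
    symm
    -- The first m + 1 letters lie inside one part of β, hence meet no interior cut.
    refine shuffleSum_of_no_cuts k _ fun i hi => ?_
    by_contra! h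
    have hi' : i ∈ cuts ([m + 1] ++ c.blocks) := by
      simpa [← hone] using hi
    rw [mem_cuts_append_lt (by simpa using h.2)] at hi'
    obtain ⟨j, rfl⟩ := hi'
    cases j with
    | zero => exact h.1 (by simp)
    | succ j => simp at h

/-- Only F_(n) involves M_(n), with coefficient 1, so the coordinate at (n) is the same in both
bases. -/
theorem coord_onePart_map_F (hΦ : IsGraded Φ) {n : ℕ} (α : Composition n) :
    (monomialBasis k).coord ⟨n, onePart n⟩ (Φ (F k ⟨n, α⟩)) = coeffF Φ α (onePart n) := by
  have hF : F k ⟨n, α⟩ ∈ homogeneousPart k n := by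
    rw [F_eq_fundamental]
    exact fundamental_mem k n _
  conv_lhs => rw [eq_sum_repr_F (hΦ n _ hF)]
  rw [map_sum]
  simp only [map_smul, coord_onePart_F, smul_eq_mul, mul_ite, mul_one, mul_zero]
  rw [Finset.sum_ite_eq' Finset.univ, if_pos (Finset.mem_univ _)]
  rfl

theorem coord_onePart_map_fundamental (hΦ : IsGraded Φ) {n : ℕ} (σ : Equiv.Perm (Fin n)) :
    (monomialBasis k).coord ⟨n, onePart n⟩ (Φ (fundamental k n (descents σ))) =
      coeffF Φ (descentComposition σ) (onePart n) := by
  rw [← F_descentComposition, coord_onePart_map_F hΦ]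

/-- The image of a fundamental quasisymmetric function: the convolution of permutations. -/
theorem map_F_descentComposition (hΦ : IsGraded Φ) {n : ℕ} (π : Equiv.Perm (Fin n)) :
    Φ (F k ⟨n, descentComposition π⟩) = ∑ τ : Equiv.Perm (Fin n),
      coeffF Φ (descentComposition (π * τ⁻¹)) (onePart n) • F k ⟨n, descentComposition τ⟩ := by
  classical
  refine (monomialBasis k).ext_elem ?_
  rintro ⟨m, β⟩
  simp only [F_descentComposition]
  simp only [← Module.Basis.coord_apply]
  by_cases hm : m = n
  · subst hm
    rw [coord_map_fundamental hΦ β π.injective, shuffleSum, map_sum, map_sum, map_sum,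
      Finset.sum_filter]
    refine Finset.sum_congr rfl fun τ _ => ?_
    rw [map_smul, coord_fundamental, smul_eq_mul, mul_ite, mul_one, mul_zero,
      ← coord_onePart_map_fundamental hΦ]
    rfl
  · rw [coord_eq_zero (hΦ n _ (fundamental_mem k n _)) hm, coord_eq_zero _ hm]
    exact Submodule.sum_mem _ fun τ _ => Submodule.smul_mem _ _ (fundamental_mem k n _)

theorem coeffF_descentComposition (hΦ : IsGraded Φ) {n : ℕ} (π : Equiv.Perm (Fin n))
    (β : Composition n) :
    coeffF Φ (descentComposition π) β = ∑ τ : Equiv.Perm (Fin n) with descentComposition τ = β,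
      coeffF Φ (descentComposition (π * τ⁻¹)) (onePart n) := by
  classical
  conv_lhs => rw [coeffF, map_F_descentComposition hΦ]
  simp only [← fundamentalBasis_apply, map_sum, map_smul, Module.Basis.repr_self,
    Finsupp.coe_finsetSum, Finset.sum_apply, Finsupp.smul_apply, Finsupp.single_apply,
    Sigma.mk.injEq, heq_eq_eq, true_and, smul_eq_mul, mul_ite, mul_one, mul_zero]
  rw [Finset.sum_filter]

/-- Cutting everywhere leaves single letters, so the shuffle sum is M_(1)ⁿ; each factor contributes
λ by multiplicativity. -/
theorem coord_onePart_map_shuffleSum_univ (hΦ : IsGraded Φ) {α : Type*} [LinearOrder α] {n : ℕ}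
    {w : Fin n → α} (hw : Function.Injective w) :
    (monomialBasis k).coord ⟨n, onePart n⟩ (Φ (shuffleSum k w Set.univ)) = scalar Φ ^ n := by
  classical
  have hM : ∀ {m : ℕ}, m ≤ 1 → ∀ v : Fin m → α,
      shuffleSum k v Set.univ = M k ⟨m, Composition.ones m⟩ := by
    intro m hm v
    rw [shuffleSum_of_no_cuts k v fun i _ => by omega, fundamental]
    have huniq : ∀ β : Composition m, β = Composition.ones m := by
      intro β
      have : Subsingleton (Composition m) := by
        rw [← Fintype.card_le_one_iff_subsingleton, composition_card]
        interval_cases m <;> simp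
      exact Subsingleton.elim _ _
    rw [Finset.sum_eq_single_of_mem (Composition.ones m)]
    · simp only [Finset.mem_filter, Finset.mem_univ, true_and, descents_subset_iff]
      intro i hi
      omega
    · exact fun β _ hβ => absurd (huniq β) hβ
  induction n with
  | zero =>
    have h1 : M k ⟨0, Composition.ones 0⟩ = 1 := Subtype.ext (monomialSeries_empty k)
    rw [hM zero_le_one, h1, map_one, ← h1, coord_M, pow_zero, if_pos]
    rw [Composition.sigma_eq_iff_blocks_eq]
    rfl
  | succ n ih =>
    have huniv : {j | n + j ∈ (Set.univ : Set ℕ)} = Set.univ := by simp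
    have hleft : Function.Injective fun i => w (Fin.castAdd 1 i) :=
      hw.comp (Fin.castAdd_injective n 1)
    rw [shuffleSum_add k hw (Set.mem_univ n), huniv, map_mul,
      coord_onePart_mul (hΦ _ _ (shuffleSum_mem k _ _)) (hΦ _ _ (shuffleSum_mem k _ _)),
      ih hleft, hM le_rfl, pow_succ]
    rfl

theorem sum_coeffF_onePart (hΦ : IsGraded Φ) (n : ℕ) :
    ∑ σ : Equiv.Perm (Fin n), coeffF Φ (descentComposition σ) (onePart n) = scalar Φ ^ n := by
  classical
  rw [← coord_onePart_map_shuffleSum_univ hΦ (w := (id : Fin n → Fin n)) Function.injective_id,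
    shuffleSum, map_sum, map_sum]
  simp only [Set.subset_univ, Finset.filter_true, id_eq]
  -- For the identity word the shuffles are the inverses τ⁻¹, so the sum is reindexed by inversion.
  rw [← Equiv.sum_comp (Equiv.inv (Equiv.Perm (Fin n)))]
  refine Finset.sum_congr rfl fun σ _ => ?_
  exact (coord_onePart_map_fundamental hΦ _).symm

end Endomorphism

/-! ### Descent classes and the subgroups they generate -/

theorem descents_eq_iff {α β : Type*} [LinearOrder α] [LinearOrder β] {n : ℕ} {w : Fin n → α}
    {v : Fin n → β} : descents w = descents v ↔ ∀ (i : ℕ) (hi : i + 1 < n),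
      w ⟨i + 1, hi⟩ < w ⟨i, by omega⟩ ↔ v ⟨i + 1, hi⟩ < v ⟨i, by omega⟩ := by
  constructor
  · intro h i hi
    rw [← succ_mem_descents hi, ← succ_mem_descents hi, h]
  · intro h
    ext j
    constructor
    · rintro ⟨i, hi, rfl, hlt⟩
      exact ⟨i, hi, rfl, (h i hi).1 hlt⟩
    · rintro ⟨i, hi, rfl, hlt⟩
      exact ⟨i, hi, rfl, (h i hi).2 hlt⟩

theorem exists_perm_descents (n : ℕ) (T : Set ℕ) :
    ∃ σ : Equiv.Perm (Fin n), ∀ i, i + 1 < n → (i + 1 ∈ descents σ ↔ i + 1 ∈ T) := by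
  classical
  -- Ranking positions by (-N, position) makes each run between elements of T increase and puts
  -- every later run below the earlier ones.
  let N : ℕ → ℤ := fun i => ((Finset.Icc 1 i).filter (· ∈ T)).card
  have hN : ∀ i, N (i + 1) = N i + if i + 1 ∈ T then 1 else 0 := by
    intro i
    simp only [N, ← Finset.insert_Icc_right_eq_Icc_add_one (show 1 ≤ i + 1 by omega),
      Finset.filter_insert]
    split_ifs
    · rw [Finset.card_insert_of_notMem (by simp)]
      push_cast
      rfl
    · simp
  obtain ⟨σ, hσ⟩ := exists_perm_lt_iff (g := fun i : Fin n => toLex (-N i, (i : ℕ)))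
    (fun i j hij => Fin.ext (Prod.mk.inj (toLex.injective hij)).2)
  refine ⟨σ, fun i hi => ?_⟩
  rw [succ_mem_descents hi, hσ, Prod.Lex.toLex_lt_toLex]
  simp only [hN]
  split_ifs with h <;> simp [h]

theorem descentComposition_surjective (n : ℕ) :
    Function.Surjective (descentComposition : Equiv.Perm (Fin n) → Composition n) := by
  intro α
  obtain ⟨σ, hσ⟩ := exists_perm_descents n (cuts α.blocks)
  refine ⟨σ, cuts_injective ?_⟩
  ext j
  rw [mem_cuts_descentComposition]
  by_cases h0 : j = 0
  · subst h0
    exact iff_of_true (Or.inl rfl) (zero_mem_cuts _)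
  by_cases hn : j = n
  · refine iff_of_true (Or.inr (Or.inl hn)) ?_
    have := sum_mem_cuts α.blocks
    rw [α.blocks_sum] at this
    rwa [hn]
  by_cases hlt : j < n
  · obtain ⟨i, rfl⟩ := Nat.exists_eq_succ_of_ne_zero h0
    simpa [hn] using hσ i hlt
  · refine iff_of_false ?_ fun h => ?_
    · rintro (h | h | h)
      · exact h0 h
      · exact hn h
      · exact hlt (lt_of_mem_descents h)
    · have := le_sum_of_mem_cuts h
      rw [α.blocks_sum] at this
      omega

/-- At a peak, the value can be raised to the largest one without changing the descents. -/
theorem exists_perm_of_peak {n : ℕ} {σ : Equiv.Perm (Fin n)} {p : Fin n}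
    (h : ∀ q : Fin n, (q : ℕ) + 1 = p ∨ (p : ℕ) + 1 = q → σ q < σ p) :
    ∃ τ : Equiv.Perm (Fin n), descents τ = descents σ ∧ ∀ q, τ q ≤ τ p := by
  classical
  obtain ⟨τ, hτ⟩ := exists_perm_lt_iff (g := fun i : Fin n => toLex (if i = p then 1 else 0, σ i))
    (fun i j hij => σ.injective (Prod.mk.inj (toLex.injective hij)).2)
  refine ⟨τ, descents_eq_iff.2 fun i hi => ?_, fun q => ?_⟩
  · rw [hτ, Prod.Lex.toLex_lt_toLex]
    by_cases h1 : (⟨i, by omega⟩ : Fin n) = p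
    · have h2 : (⟨i + 1, hi⟩ : Fin n) ≠ p := by
        rintro rfl
        simp at h1
      have := h ⟨i + 1, hi⟩ (Or.inr (by simp [← h1]))
      simp [h2, h1, this]
    · by_cases h2 : (⟨i + 1, hi⟩ : Fin n) = p
      · have := h ⟨i, by omega⟩ (Or.inl (by simp [← h2]))
        simp [h2, h1, this.le]
      · simp [h2, h1]
  · rw [← not_lt, hτ, Prod.Lex.toLex_lt_toLex]
    by_cases hq : q = p <;> simp [hq]

/-- At a valley, the value can be lowered to the smallest one without changing the descents. -/
theorem exists_perm_of_valley {n : ℕ} {σ : Equiv.Perm (Fin n)} {p : Fin n}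
    (h : ∀ q : Fin n, (q : ℕ) + 1 = p ∨ (p : ℕ) + 1 = q → σ p < σ q) :
    ∃ τ : Equiv.Perm (Fin n), descents τ = descents σ ∧ ∀ q, τ p ≤ τ q := by
  classical
  obtain ⟨τ, hτ⟩ := exists_perm_lt_iff (g := fun i : Fin n => toLex (if i = p then 0 else 1, σ i))
    (fun i j hij => σ.injective (Prod.mk.inj (toLex.injective hij)).2)
  refine ⟨τ, descents_eq_iff.2 fun i hi => ?_, fun q => ?_⟩
  · rw [hτ, Prod.Lex.toLex_lt_toLex]
    by_cases h1 : (⟨i, by omega⟩ : Fin n) = p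
    · have h2 : (⟨i + 1, hi⟩ : Fin n) ≠ p := by
        rintro rfl
        simp at h1
      have := h ⟨i + 1, hi⟩ (Or.inr (by simp [← h1]))
      simp [h2, h1, this.le]
    · by_cases h2 : (⟨i + 1, hi⟩ : Fin n) = p
      · have := h ⟨i, by omega⟩ (Or.inl (by simp [← h2]))
        simp [h2, h1, this]
      · simp [h2, h1]
  · rw [← not_lt, hτ, Prod.Lex.toLex_lt_toLex]
    by_cases hq : q = p <;> simp [hq]

/-- No value lies between x and y, so exchanging them affects no comparison other than the one
between x and y themselves. -/
theorem swap_apply_lt_swap_apply_iff {n : ℕ} {x y a b : Fin n} (hxy : (x : ℕ) + 1 = y)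
    (h1 : ¬ (a = x ∧ b = y)) (h2 : ¬ (a = y ∧ b = x)) :
    Equiv.swap x y a < Equiv.swap x y b ↔ a < b := by
  simp only [Fin.ext_iff] at h1 h2
  simp only [Equiv.swap_apply_def, Fin.ext_iff]
  split_ifs <;> simp only [Fin.lt_def] <;> omega

/-- Exchanging two consecutive values on different sides of `p` preserves the descents. -/
theorem descents_swap_mul {n : ℕ} {σ : Equiv.Perm (Fin n)} {p x y : Fin n}
    (hxy : (x : ℕ) + 1 = y ∨ (y : ℕ) + 1 = x) (hx : σ p ≠ x) (hy : σ p ≠ y)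
    (hside : σ⁻¹ x < p ↔ ¬ σ⁻¹ y < p) : descents (Equiv.swap x y * σ) = descents σ := by
  wlog h : (x : ℕ) + 1 = y generalizing x y
  · rw [Equiv.swap_comm]
    exact this hxy.symm hy hx (by tauto) (hxy.resolve_left h)
  -- The positions of x and y are separated by p and neither equals p, so they are not adjacent; the
  -- only affected comparison is never one between neighbours.
  have key : ∀ (i : ℕ) (hi : i + 1 < n) (u v : Fin n), (u = x ∧ v = y ∨ u = y ∧ v = x) →
      ¬ (σ ⟨i, by omega⟩ = u ∧ σ ⟨i + 1, hi⟩ = v) := by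
    rintro i hi u v huv ⟨hu, hv⟩
    have hu' : σ⁻¹ u = ⟨i, by omega⟩ := by simp [← hu]
    have hv' : σ⁻¹ v = ⟨i + 1, hi⟩ := by simp [← hv]
    have hp1 : (p : ℕ) ≠ i := by
      intro h
      obtain rfl : p = ⟨i, Nat.lt_of_succ_lt hi⟩ := Fin.ext h
      rcases huv with ⟨rfl, -⟩ | ⟨rfl, -⟩
      · exact hx hu
      · exact hy hu
    rcases huv with ⟨rfl, rfl⟩ | ⟨rfl, rfl⟩ <;>
    · rw [hu', hv', Fin.lt_def, Fin.lt_def] at hside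
      simp only at hside
      have hp2 : (p : ℕ) ≠ i + 1 := by
        intro h
        obtain rfl : p = ⟨i + 1, hi⟩ := Fin.ext h
        tauto
      omega
  refine descents_eq_iff.2 fun i hi => ?_
  refine swap_apply_lt_swap_apply_iff h ?_ ?_
  · intro h
    exact key i hi y x (Or.inr ⟨rfl, rfl⟩) ⟨h.2, h.1⟩
  · intro h
    exact key i hi x y (Or.inl ⟨rfl, rfl⟩) ⟨h.2, h.1⟩

section Generation

variable {n : ℕ} {T : Set ℕ} {p e : Fin n}

theorem swap_mem_of_swap_mul {σ : Equiv.Perm (Fin n)} {x y : Fin n} (hσ : descents σ = T)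
    (h : descents (Equiv.swap x y * σ) = T) :
    Equiv.swap x y ∈ Subgroup.closure {σ : Equiv.Perm (Fin n) | descents σ = T} := by
  have h1 := Subgroup.subset_closure
    (show Equiv.swap x y * σ ∈ {σ : Equiv.Perm (Fin n) | descents σ = T} from h)
  have h2 := Subgroup.subset_closure
    (show σ ∈ {σ : Equiv.Perm (Fin n) | descents σ = T} from hσ)
  simpa using Subgroup.mul_mem _ h1 (Subgroup.inv_mem _ h2)

/-- If the values `a` and `v` lie on different sides of `p`, the value `v` can be moved step by step
towards `a` until its neighbour `b` can be exchanged with `a`. -/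
theorem swap_mem_of_side (he : (∀ x, e ≤ x) ∨ ∀ x, x ≤ e) (d : ℕ) :
    ∀ (σ : Equiv.Perm (Fin n)) (a b v : Fin n), descents σ = T → σ p = e → a ≠ e → b ≠ e → v ≠ e →
      ((b : ℕ) = a + 1 ∧ (v : ℕ) = a + (d + 1) ∨ (a : ℕ) = b + 1 ∧ (a : ℕ) = v + (d + 1)) →
      (σ⁻¹ a < p ↔ ¬ σ⁻¹ v < p) →
      Equiv.swap a b ∈ Subgroup.closure {σ : Equiv.Perm (Fin n) | descents σ = T} := by
  induction d with
  | zero =>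
    intro σ a b v hσ hp ha hb hv hd hside
    obtain rfl : v = b := Fin.ext (by omega)
    refine swap_mem_of_swap_mul hσ ?_
    rw [descents_swap_mul (p := p) (by omega) (by rw [hp]; exact ha.symm)
      (by rw [hp]; exact hb.symm) hside, hσ]
  | succ d ih =>
    intro σ a b v hσ hp ha hb hv hd hside
    obtain ⟨u, hu⟩ : ∃ u : Fin n, (b : ℕ) = a + 1 ∧ (u : ℕ) = a + (d + 1) ∧ (v : ℕ) = u + 1 ∨
        (a : ℕ) = b + 1 ∧ (a : ℕ) = u + (d + 1) ∧ (u : ℕ) = v + 1 := by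
      rcases hd with h | h
      · exact ⟨⟨a + (d + 1), by omega⟩, Or.inl ⟨h.1, rfl, by simp only; omega⟩⟩
      · exact ⟨⟨v + 1, by omega⟩, Or.inr ⟨h.1, by simp only; omega, rfl⟩⟩
    -- The value u lies strictly between a and v, so it cannot be extreme.
    have hue : u ≠ e := by
      rintro rfl
      rcases he with he | he
      · have h1 := Fin.le_def.1 (he a)
        have h2 := Fin.le_def.1 (he v)
        omega
      · have h1 := Fin.le_def.1 (he a)
        have h2 := Fin.le_def.1 (he v)
        omega
    by_cases hs : σ⁻¹ u < p ↔ σ⁻¹ v < p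
    · exact ih σ a b u hσ hp ha hb hue (by omega) (by rw [hside, hs])
    · have hau : a ≠ u := by
        intro h
        rw [Fin.ext_iff] at h
        omega
      have hav : a ≠ v := by
        intro h
        rw [Fin.ext_iff] at h
        omega
      -- Here u and v lie on different sides of p. Exchanging them stays in the descent class and
      -- puts u where v was, opposite to a.
      refine ih (Equiv.swap u v * σ) a b u ?_ ?_ ha hb hue (by omega) ?_
      · rw [descents_swap_mul (p := p) (by omega) (by rw [hp]; exact hue.symm)
          (by rw [hp]; exact hv.symm) (by tauto), hσ]
      · rw [Equiv.Perm.mul_apply, hp, Equiv.swap_apply_of_ne_of_ne hue.symm hv.symm]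
      · simp only [mul_inv_rev, Equiv.swap_inv, Equiv.Perm.mul_apply,
          Equiv.swap_apply_of_ne_of_ne hau hav, Equiv.swap_apply_left]
        exact hside

theorem swap_mem_trans {G : Subgroup (Equiv.Perm (Fin n))} {x y z : Fin n}
    (h1 : Equiv.swap x y ∈ G) (h2 : Equiv.swap y z ∈ G) : Equiv.swap x z ∈ G := by
  by_cases hxy : x = y
  · rwa [hxy]
  by_cases hxz : x = z
  · rw [hxz, Equiv.swap_self]
    exact one_mem G
  rw [Equiv.swap_comm, ← Equiv.swap_mul_swap_mul_swap hxy hxz]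
  exact mul_mem (mul_mem h2 h1) h2

/-- Since p is interior, both sides of it hold positions, so two consecutive values on the same side
can be exchanged with the help of a value from the other side. This gives the symmetric group on the
values other than e; conjugation by σ then reaches e, because p ≠ e as elements of `Fin n`. -/
theorem closure_descents_eq_top_of_extreme (he : (∀ x, e ≤ x) ∨ ∀ x, x ≤ e)
    (hp0 : 0 < (p : ℕ)) (hpn : (p : ℕ) + 1 < n) {σ : Equiv.Perm (Fin n)} (hσ : descents σ = T)
    (hσp : σ p = e) : Subgroup.closure {σ : Equiv.Perm (Fin n) | descents σ = T} = ⊤ := by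
  set G := Subgroup.closure {σ : Equiv.Perm (Fin n) | descents σ = T} with hG
  have hpv : ∀ q, q ≠ p → σ q ≠ e := fun q hq h => hq (σ.injective (h.trans hσp.symm))
  have hcons : ∀ a b : Fin n, a ≠ e → b ≠ e → (b : ℕ) = a + 1 → Equiv.swap a b ∈ G := by
    intro a b ha hb hab
    by_cases hs : σ⁻¹ a < p ↔ σ⁻¹ b < p
    · obtain ⟨q, hqp, hq⟩ : ∃ q, q ≠ p ∧ (σ⁻¹ a < p ↔ ¬ q < p) := by
        by_cases h : σ⁻¹ a < p
        · refine ⟨⟨p + 1, hpn⟩, ?_, ?_⟩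
          · simp [Fin.ext_iff]
          · exact iff_of_true h (by rw [Fin.lt_def]; simp)
        · refine ⟨⟨p - 1, by omega⟩, ?_, ?_⟩
          · simp only [Ne, Fin.ext_iff]; omega
          · exact iff_of_false h (not_not.2 (by rw [Fin.lt_def]; simp only; omega))
      have hq' : q = σ⁻¹ (σ q) := by simp
      have hva : σ q ≠ a := by
        rintro rfl
        rw [← hq'] at hq
        tauto
      have hvb : σ q ≠ b := by
        rintro rfl
        rw [← hq'] at hs
        tauto
      rw [Ne, Fin.ext_iff] at hva hvb
      rw [hq'] at hq
      -- The helper value is moved until it reaches the nearer of a and b, and is then exchanged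
      -- with the farther one.
      rcases lt_or_ge (σ q : ℕ) a with hlt | hge
      · rw [Equiv.swap_comm]
        exact swap_mem_of_side he (b - (σ q : ℕ) - 1) σ b a (σ q) hσ hσp hb ha (hpv q hqp)
          (by omega) (by rw [← hs, hq])
      · exact swap_mem_of_side he ((σ q : ℕ) - a - 1) σ a b (σ q) hσ hσp ha hb (hpv q hqp)
          (by omega) hq
    · exact swap_mem_of_side he 0 σ a b b hσ hσp ha hb hb (by omega) (by tauto)
  have hall : ∀ (m : ℕ) (a b : Fin n), a ≠ e → b ≠ e → (b : ℕ) = a + m → Equiv.swap a b ∈ G := by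
    intro m
    induction m with
    | zero =>
      intro a b _ _ hab
      obtain rfl : b = a := Fin.ext hab
      rw [Equiv.swap_self]
      exact one_mem G
    | succ m ih =>
      intro a b ha hb hab
      have hue : (⟨a + m, by omega⟩ : Fin n) ≠ e := by
        intro h
        have h' := congrArg Fin.val h
        simp only at h'
        rw [Ne, Fin.ext_iff] at ha hb
        rcases he with he | he
        · have h1 := Fin.le_def.1 (he a)
          omega
        · have h1 := Fin.le_def.1 (he b)
          omega
      exact swap_mem_trans (ih a _ ha hue rfl) (hcons _ b hue hb (by simp only; omega))
  have hne : ∀ a b : Fin n, a ≠ e → b ≠ e → Equiv.swap a b ∈ G := by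
    intro a b ha hb
    rcases le_total (a : ℕ) b with h | h
    · exact hall (b - a) a b ha hb (by omega)
    · rw [Equiv.swap_comm]
      exact hall (a - b) b a hb ha (by omega)
  have hpe : p ≠ e := by
    rintro rfl
    rcases he with he | he
    · have := Fin.le_def.1 (he ⟨0, by omega⟩)
      simp only at this
      omega
    · have := Fin.le_def.1 (he ⟨p + 1, hpn⟩)
      simp only at this
      omega
  obtain ⟨c, hcp, hce⟩ : ∃ c, c ≠ p ∧ c ≠ e := by
    by_contra! h
    have h1 := h ⟨p + 1, hpn⟩ (by simp [Fin.ext_iff])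
    have h2 := h ⟨p - 1, by omega⟩ (by simp only [Ne, Fin.ext_iff]; omega)
    have := congrArg Fin.val (h1.trans h2.symm)
    simp only at this
    omega
  have hσG : σ ∈ G := Subgroup.subset_closure hσ
  have hc : Equiv.swap (σ c) e ∈ G := by
    -- Conjugating the transposition of c and p by σ gives that of σ c and σ p = e.
    rw [← hσp, Equiv.swap_apply_apply]
    exact mul_mem (mul_mem hσG (hne c p hce hpe)) (inv_mem hσG)
  have hxe : ∀ x, Equiv.swap x e ∈ G := by
    intro x
    by_cases hx : x = e
    · rw [hx, Equiv.swap_self]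
      exact one_mem G
    · exact swap_mem_trans (hne x (σ c) hx (hpv c hcp)) hc
  rw [eq_top_iff, ← Equiv.Perm.closure_isSwap, Subgroup.closure_le]
  rintro _ ⟨x, y, -, rfl⟩
  refine swap_mem_trans (hxe x) ?_
  rw [Equiv.swap_comm]
  exact hxe y

end Generation

/-- A descent followed by an ascent is a valley, an ascent followed by a descent a peak. The class
has a member with the minimum, respectively the maximum, at that position. -/
theorem closure_descents_eq_top {n i : ℕ} (hi : i + 2 < n) (σ : Equiv.Perm (Fin n))
    (h : i + 1 ∈ descents σ ↔ ¬ i + 2 ∈ descents σ) :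
    Subgroup.closure {τ : Equiv.Perm (Fin n) | descents τ = descents σ} = ⊤ := by
  set p : Fin n := ⟨i + 1, by omega⟩ with hp
  have h1 : i + 1 ∈ descents σ ↔ σ p < σ ⟨i, by omega⟩ := succ_mem_descents (by omega)
  have h2 : i + 2 ∈ descents σ ↔ σ ⟨i + 2, hi⟩ < σ p := succ_mem_descents (i := i + 1) (by omega)
  have hne1 : σ p ≠ σ ⟨i, by omega⟩ := by simp [hp]
  have hne2 : σ p ≠ σ ⟨i + 2, hi⟩ := by simp [hp]
  rw [h1, h2] at h
  by_cases hd : σ p < σ ⟨i, by omega⟩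
  · obtain ⟨τ, hτ, hmin⟩ := exists_perm_of_valley (σ := σ) (p := p) (by
      intro q hq
      rcases hq with hq | hq
      · rw [show q = ⟨i, by omega⟩ from Fin.ext (by simp only [hp] at hq; simp only; omega)]
        exact hd
      · rw [show q = ⟨i + 2, hi⟩ from Fin.ext (by simp only [hp] at hq; simp only; omega)]
        exact lt_of_le_of_ne (not_lt.1 (h.1 hd)) hne2)
    refine closure_descents_eq_top_of_extreme (p := p) (e := τ p) (Or.inl fun x => ?_)
      (by simp [hp]) (by simp only [hp]; omega) hτ rfl
    simpa using hmin (τ⁻¹ x)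
  · obtain ⟨τ, hτ, hmax⟩ := exists_perm_of_peak (σ := σ) (p := p) (by
      intro q hq
      rcases hq with hq | hq
      · rw [show q = ⟨i, by omega⟩ from Fin.ext (by simp only [hp] at hq; simp only; omega)]
        exact lt_of_le_of_ne (not_lt.1 hd) hne1.symm
      · rw [show q = ⟨i + 2, hi⟩ from Fin.ext (by simp only [hp] at hq; simp only; omega)]
        exact not_not.1 (mt h.2 hd))
    refine closure_descents_eq_top_of_extreme (p := p) (e := τ p) (Or.inr fun x => ?_)
      (by simp [hp]) (by simp only [hp]; omega) hτ rfl
    simpa using hmax (τ⁻¹ x)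

theorem cuts_ones (n i : ℕ) (hi : i ≤ n) : i ∈ cuts (Composition.ones n).blocks :=
  ⟨i, by simp [List.take_replicate, hi]⟩

theorem closure_descentComposition_eq_top {n : ℕ} (α : Composition n) (h1 : α ≠ onePart n)
    (h2 : α ≠ Composition.ones n) :
    Subgroup.closure {σ : Equiv.Perm (Fin n) | descentComposition σ = α} = ⊤ := by
  obtain ⟨σ, rfl⟩ := descentComposition_surjective n α
  simp only [descentComposition_eq_iff]
  obtain ⟨a, ha⟩ : ∃ a, a + 1 < n ∧ a + 1 ∈ descents σ := by
    by_contra! h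
    apply h1
    refine cuts_injective (Set.Subset.antisymm ?_ (cuts_onePart_subset _))
    rw [cuts_descentComposition_subset _ (onePart n).blocks_sum, descents_subset_iff]
    intro i hi hlt
    exact absurd ((succ_mem_descents hi).2 hlt) (h i hi)
  obtain ⟨b, hb⟩ : ∃ b, b + 1 < n ∧ b + 1 ∉ descents σ := by
    by_contra! h
    apply h2
    apply cuts_injective
    ext j
    rw [mem_cuts_descentComposition]
    constructor
    · rintro (rfl | rfl | hj)
      · exact zero_mem_cuts _
      · exact cuts_ones j j le_rfl
      · exact cuts_ones n j (lt_of_mem_descents hj).le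
    · intro hj
      have := le_sum_of_mem_cuts hj
      rw [Composition.blocks_sum] at this
      by_cases h0 : j = 0
      · exact Or.inl h0
      · by_cases hn : j = n
        · exact Or.inr (Or.inl hn)
        · obtain ⟨i, rfl⟩ := Nat.exists_eq_succ_of_ne_zero h0
          exact Or.inr (Or.inr (h i (by omega)))
  -- If consecutive positions always agreed, all would be descents or none would.
  obtain ⟨i, hi, h⟩ : ∃ i, i + 2 < n ∧ (i + 1 ∈ descents σ ↔ ¬ i + 2 ∈ descents σ) := by
    by_contra! h
    have hconst : ∀ i, i + 1 < n → (i + 1 ∈ descents σ ↔ 1 ∈ descents σ) := by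
      intro i
      induction i with
      | zero => exact fun _ => Iff.rfl
      | succ i ih =>
        intro hi
        rw [← ih (by omega)]
        have := h i hi
        tauto
    exact hb.2 ((hconst b hb.1).2 ((hconst a ha.1).1 ha.2))
  exact closure_descents_eq_top hi σ h

/-! ### Harmonic functions and stationary distributions -/

section MarkovChain

variable {ι : Type*} [Fintype ι] [DecidableEq ι]

/-- If the harmonic functions of a stochastic matrix are constant, it has at most one stationary
distribution. -/
theorem IsStationary.unique {P : Matrix ι ι ℝ} (hP : P ∈ Matrix.rowStochastic ℝ ι)
    (hharm : ∀ v : ι → ℝ, P.mulVec v = v → ∀ i j, v i = v j) {μ ν : ι → ℝ}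
    (hμ : IsStationary P μ) (hν : IsStationary P ν) : μ = ν := by
  have hker : ∀ v, v ∈ LinearMap.ker (1 - P).mulVecLin ↔ P.mulVec v = v := by
    intro v
    rw [LinearMap.mem_ker, Matrix.mulVecLin_apply, Matrix.sub_mulVec, Matrix.one_mulVec, sub_eq_zero,
      eq_comm]
  have hker' : ∀ v, v ∈ LinearMap.ker (1 - P).transpose.mulVecLin ↔ Matrix.vecMul v P = v := by
    intro v
    rw [LinearMap.mem_ker, Matrix.mulVecLin_apply, Matrix.mulVec_transpose, Matrix.vecMul_sub,
      Matrix.vecMul_one, sub_eq_zero, eq_comm]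
  have hdim : Module.finrank ℝ (LinearMap.ker (1 - P).mulVecLin) ≤ 1 := by
    refine finrank_le_one ⟨1, (hker 1).2 hP.2⟩ ?_
    rintro ⟨v, hv⟩
    rcases isEmpty_or_nonempty ι with h | ⟨⟨i⟩⟩
    · exact ⟨0, Subtype.ext (Subsingleton.elim _ _)⟩
    · refine ⟨v i, Subtype.ext (funext fun j => ?_)⟩
      simpa using hharm v ((hker v).1 hv) i j
  -- Row rank equals column rank, so the left fixed vectors form a space of the same dimension as
  -- the harmonic functions.
  have hdim' : Module.finrank ℝ (LinearMap.ker (1 - P).transpose.mulVecLin) ≤ 1 := by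
    have h1 := LinearMap.finrank_range_add_finrank_ker (1 - P).mulVecLin
    have h2 := LinearMap.finrank_range_add_finrank_ker (1 - P).transpose.mulVecLin
    have h3 := Matrix.rank_transpose (1 - P)
    unfold Matrix.rank at h3
    omega
  obtain ⟨v, hv⟩ := finrank_le_one_iff.1 hdim'
  obtain ⟨a, ha⟩ := hv ⟨μ, (hker' μ).2 hμ.2⟩
  obtain ⟨b, hb⟩ := hv ⟨ν, (hker' ν).2 hν.2⟩
  replace ha : a • (v : ι → ℝ) = μ := congrArg Subtype.val ha
  replace hb : b • (v : ι → ℝ) = ν := congrArg Subtype.val hb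
  have hsa : a * ∑ i, (v : ι → ℝ) i = 1 := by
    rw [← hμ.1.2, ← ha, Finset.mul_sum]
    rfl
  have hsb : b * ∑ i, (v : ι → ℝ) i = 1 := by
    rw [← hν.1.2, ← hb, Finset.mul_sum]
    rfl
  have hab : a = b := mul_right_cancel₀ (right_ne_zero_of_mul_eq_one hsa) (hsa.trans hsb.symm)
  rw [← ha, ← hb, hab]

/-- The maximum principle: from a maximum of a harmonic function, the chain can only move to other
maxima. -/
theorem harmonic_eq_of_max {P : Matrix ι ι ℝ} (hP : P ∈ Matrix.rowStochastic ℝ ι) {v : ι → ℝ}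
    (hv : P.mulVec v = v) {i j : ι} (hmax : ∀ l, v l ≤ v i) (hij : 0 < P i j) : v j = v i := by
  -- The deficits below the maximum are nonnegative with mean zero, so those of positive probability
  -- vanish.
  have hsum : ∑ l, P i l * (v i - v l) = 0 := by
    have h1 : ∑ l, P i l * v l = v i := congrFun hv i
    have h2 : ∑ l, P i l = 1 := by
      have := congrFun hP.2 i
      simpa [Matrix.mulVec, dotProduct] using this
    simp only [mul_sub, Finset.sum_sub_distrib, ← Finset.sum_mul, h1, h2, one_mul, sub_self]
  have := (Finset.sum_eq_zero_iff_of_nonneg fun l _ =>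
    mul_nonneg (hP.1 i l) (sub_nonneg.2 (hmax l))).1 hsum j (Finset.mem_univ j)
  have := (mul_eq_zero.1 this).resolve_left hij.ne'
  linarith

end MarkovChain

/-! ### The walk on permutations and its lumping -/

section Walk

variable {k : Type*} [Field k] [Algebra k ℝ] {Φ : quasisymmetric k →ₐc[k] quasisymmetric k} {n : ℕ}

theorem sum_algebraMap_coeffF (hΦ : IsGraded Φ) (n : ℕ) :
    ∑ σ : Equiv.Perm (Fin n), algebraMap k ℝ (coeffF Φ (descentComposition σ) (onePart n)) =
      algebraMap k ℝ (scalar Φ) ^ n := by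
  rw [← map_sum, sum_coeffF_onePart hΦ, map_pow]

theorem prob_eq (hΦ : IsGraded Φ) (π : Equiv.Perm (Fin n)) :
    prob Φ π = algebraMap k ℝ (coeffF Φ (descentComposition π) (onePart n)) /
      algebraMap k ℝ (scalar Φ) ^ n := by
  rw [prob, sum_algebraMap_coeffF hΦ]

theorem K_apply (π τ : Equiv.Perm (Fin n)) : K Φ n π τ = prob Φ (π * τ⁻¹) := by
  rw [K, mul_inv_rev, inv_inv]

theorem Kbar_descentComposition (hΦ : IsGraded Φ) (π : Equiv.Perm (Fin n)) (β : Composition n) :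
    Kbar Φ n (descentComposition π) β =
      ∑ σ : Equiv.Perm (Fin n) with descentComposition σ = β, K Φ n π σ := by
  rw [Kbar, coeffF_descentComposition hΦ, map_sum, Finset.sum_div]
  refine Finset.sum_congr rfl fun σ _ => ?_
  rw [K_apply, prob_eq hΦ]

/-- λⁿ is a sum of nonnegative terms over all permutations, and every composition occurs as a
descent composition, so the positive coefficient appears in it. -/
theorem scalar_pow_pos (hΦ : IsGraded Φ)
    (hnonneg : ∀ α : Composition n, 0 ≤ algebraMap k ℝ (coeffF Φ α (onePart n)))
    {α : Composition n} (hpos : 0 < algebraMap k ℝ (coeffF Φ α (onePart n))) :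
    0 < algebraMap k ℝ (scalar Φ) ^ n := by
  rw [← sum_algebraMap_coeffF hΦ]
  obtain ⟨σ, rfl⟩ := descentComposition_surjective n α
  exact Finset.sum_pos' (fun σ _ => hnonneg _) ⟨σ, Finset.mem_univ _, hpos⟩

theorem sum_prob (hΦ : IsGraded Φ) (hpos : 0 < algebraMap k ℝ (scalar Φ) ^ n) :
    ∑ σ : Equiv.Perm (Fin n), prob Φ σ = 1 := by
  simp only [prob_eq hΦ]
  rw [← Finset.sum_div, sum_algebraMap_coeffF hΦ, div_self hpos.ne']

theorem sum_K_row (hΦ : IsGraded Φ) (hpos : 0 < algebraMap k ℝ (scalar Φ) ^ n)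
    (π : Equiv.Perm (Fin n)) : ∑ τ, K Φ n π τ = 1 := by
  simp only [K_apply]
  rw [← sum_prob hΦ hpos]
  exact Equiv.sum_comp ((Equiv.inv _).trans (Equiv.mulLeft π)) (prob Φ)

theorem sum_K_col (hΦ : IsGraded Φ) (hpos : 0 < algebraMap k ℝ (scalar Φ) ^ n)
    (τ : Equiv.Perm (Fin n)) : ∑ π, K Φ n π τ = 1 := by
  simp only [K_apply]
  rw [← sum_prob hΦ hpos]
  exact Equiv.sum_comp (Equiv.mulRight τ⁻¹) (prob Φ)

theorem K_mem_rowStochastic (hΦ : IsGraded Φ)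
    (hnonneg : ∀ α : Composition n, 0 ≤ algebraMap k ℝ (coeffF Φ α (onePart n)))
    (hpos : 0 < algebraMap k ℝ (scalar Φ) ^ n) :
    K Φ n ∈ Matrix.rowStochastic ℝ (Equiv.Perm (Fin n)) := by
  refine ⟨fun π τ => ?_, funext fun π => ?_⟩
  · rw [K_apply, prob_eq hΦ]
    exact div_nonneg (hnonneg _) hpos.le
  · simpa [Matrix.mulVec, dotProduct] using sum_K_row hΦ hpos π

theorem Kbar_mem_rowStochastic (hΦ : IsGraded Φ)
    (hnonneg : ∀ α : Composition n, 0 ≤ algebraMap k ℝ (coeffF Φ α (onePart n)))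
    (hpos : 0 < algebraMap k ℝ (scalar Φ) ^ n) :
    Kbar Φ n ∈ Matrix.rowStochastic ℝ (Composition n) := by
  refine ⟨fun α β => ?_, funext fun α => ?_⟩
  · obtain ⟨π, rfl⟩ := descentComposition_surjective n α
    rw [Kbar_descentComposition hΦ]
    exact Finset.sum_nonneg fun σ _ => (K_mem_rowStochastic hΦ hnonneg hpos).1 π σ
  · obtain ⟨π, rfl⟩ := descentComposition_surjective n α
    simp only [Matrix.mulVec, dotProduct, Pi.one_apply, mul_one, Kbar_descentComposition hΦ]
    rw [Finset.sum_fiberwise Finset.univ descentComposition, sum_K_row hΦ hpos]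

/-- From π the walk reaches x⁻¹π with positive probability for each x in the class of α. The set of
maxima is therefore stable under these left multiplications, which generate the whole group. -/
theorem harmonic_K_const (hΦ : IsGraded Φ)
    (hnonneg : ∀ α : Composition n, 0 ≤ algebraMap k ℝ (coeffF Φ α (onePart n)))
    {α : Composition n} (hα : 0 < algebraMap k ℝ (coeffF Φ α (onePart n)))
    (h1 : α ≠ onePart n) (h2 : α ≠ Composition.ones n) {v : Equiv.Perm (Fin n) → ℝ}
    (hv : (K Φ n).mulVec v = v) (π τ : Equiv.Perm (Fin n)) : v π = v τ := by
  have hpos := scalar_pow_pos hΦ hnonneg hα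
  obtain ⟨π₀, hmax⟩ := Finite.exists_max v
  have hstep : ∀ x ∈ {σ : Equiv.Perm (Fin n) | descentComposition σ = α}, ∀ π, v π = v π₀ →
      v (x⁻¹ * π) = v π₀ := by
    rintro x rfl π hπ
    refine (harmonic_eq_of_max (K_mem_rowStochastic hΦ hnonneg hpos) hv (i := π) ?_ ?_).trans hπ
    · rw [hπ]
      exact hmax
    · rw [K_apply, prob_eq hΦ]
      simpa using div_pos hα hpos
  have hall : ∀ x : Equiv.Perm (Fin n), ∀ π, v π = v π₀ → v (x⁻¹ * π) = v π₀ := by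
    intro x
    have hx : x ∈ Submonoid.closure {σ : Equiv.Perm (Fin n) | descentComposition σ = α} := by
      -- The walk moves only by generators, not their inverses; in a finite group the submonoid they
      -- generate is already the subgroup.
      rw [← Subgroup.closure_toSubmonoid_of_finite, closure_descentComposition_eq_top α h1 h2]
      trivial
    induction hx using Submonoid.closure_induction with
    | mem x hx => exact hstep x hx
    | one => simp
    | mul x y _ _ hx hy =>
      intro π hπ
      rw [mul_inv_rev, mul_assoc]
      exact hy _ (hx _ hπ)
  have hconst : ∀ π, v π = v π₀ := fun π => by simpa using hall (π₀ * π⁻¹) π₀ rfl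
  exact (hconst π).trans (hconst τ).symm

/-- By lumping, a harmonic function of K̄ composed with D is harmonic for K, and D is surjective. -/
theorem harmonic_Kbar_const (hΦ : IsGraded Φ)
    (hnonneg : ∀ α : Composition n, 0 ≤ algebraMap k ℝ (coeffF Φ α (onePart n)))
    {α : Composition n} (hα : 0 < algebraMap k ℝ (coeffF Φ α (onePart n)))
    (h1 : α ≠ onePart n) (h2 : α ≠ Composition.ones n) {v : Composition n → ℝ}
    (hv : (Kbar Φ n).mulVec v = v) (β γ : Composition n) : v β = v γ := by
  obtain ⟨π, rfl⟩ := descentComposition_surjective n β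
  obtain ⟨τ, rfl⟩ := descentComposition_surjective n γ
  refine harmonic_K_const hΦ hnonneg hα h1 h2 (v := v ∘ descentComposition) (funext fun σ => ?_) π τ
  refine Eq.trans ?_ (congrFun hv (descentComposition σ))
  simp only [Matrix.mulVec, dotProduct, Kbar_descentComposition hΦ, Finset.sum_mul,
    Function.comp_apply]
  rw [← Finset.sum_fiberwise Finset.univ descentComposition]
  refine Finset.sum_congr rfl fun β _ => Finset.sum_congr rfl fun τ hτ => ?_
  rw [(Finset.mem_filter.1 hτ).2]

theorem isStationary_uniformDist (hΦ : IsGraded Φ) (hpos : 0 < algebraMap k ℝ (scalar Φ) ^ n) :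
    IsStationary (K Φ n) (uniformDist n) := by
  refine ⟨⟨fun σ => by unfold uniformDist; positivity, ?_⟩, funext fun τ => ?_⟩
  · simp only [uniformDist, Finset.sum_const, Finset.card_univ, Fintype.card_perm, Fintype.card_fin,
      nsmul_eq_mul]
    field_simp
  · simp only [Matrix.vecMul, dotProduct, uniformDist]
    rw [← Finset.mul_sum, sum_K_col hΦ hpos, mul_one]

theorem descentDist_eq_sum (β : Composition n) : descentDist n β =
    ∑ σ : Equiv.Perm (Fin n) with descentComposition σ = β, uniformDist n σ := by
  simp only [descentDist, uniformDist, Finset.sum_const, nsmul_eq_mul]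
  ring

theorem isStationary_descentDist (hΦ : IsGraded Φ) (hpos : 0 < algebraMap k ℝ (scalar Φ) ^ n) :
    IsStationary (Kbar Φ n) (descentDist n) := by
  have hunif := isStationary_uniformDist hΦ hpos
  refine ⟨⟨fun β => by unfold descentDist; positivity, ?_⟩, funext fun β => ?_⟩
  · simp only [descentDist_eq_sum]
    rw [Finset.sum_fiberwise Finset.univ descentComposition, hunif.1.2]
  · simp only [Matrix.vecMul, dotProduct, descentDist_eq_sum, Finset.sum_mul]
    calc ∑ α, ∑ σ : Equiv.Perm (Fin n) with descentComposition σ = α, uniformDist n σ * Kbar Φ n α β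
        = ∑ α, ∑ σ : Equiv.Perm (Fin n) with descentComposition σ = α,
            uniformDist n σ * Kbar Φ n (descentComposition σ) β := by
          refine Finset.sum_congr rfl fun α _ => Finset.sum_congr rfl fun σ hσ => ?_
          rw [(Finset.mem_filter.1 hσ).2]
      _ = ∑ σ, uniformDist n σ * Kbar Φ n (descentComposition σ) β :=
          Finset.sum_fiberwise Finset.univ descentComposition _
      _ = ∑ τ : Equiv.Perm (Fin n) with descentComposition τ = β,
            ∑ σ, uniformDist n σ * K Φ n σ τ := by
          simp only [Kbar_descentComposition hΦ, Finset.mul_sum]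
          exact Finset.sum_comm
      _ = _ := Finset.sum_congr rfl fun τ _ => congrFun hunif.2 τ

end Walk

end QSymWalk

theorem theorem3p8 {k : Type*} [Field k] [Algebra k ℝ]
    (Φ : QSym.quasisymmetric k →ₐc[k] QSym.quasisymmetric k) (hΦ : QSym.IsGraded Φ) (n : ℕ)
    (hnonneg : ∀ α : Composition n,
      0 ≤ algebraMap k ℝ (QSym.coeffF Φ α (QSymWalk.onePart n)))
    (hpos : ∃ α : Composition n, α ≠ QSymWalk.onePart n ∧ α ≠ Composition.ones n ∧
      0 < algebraMap k ℝ (QSym.coeffF Φ α (QSymWalk.onePart n))) :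
    -- the two chains are well defined, and `K̄` lumps `K` by descent sets
    0 < algebraMap k ℝ (QSym.scalar Φ) ^ n ∧
    QSymWalk.K Φ n ∈ Matrix.rowStochastic ℝ (Equiv.Perm (Fin n)) ∧
    QSymWalk.Kbar Φ n ∈ Matrix.rowStochastic ℝ (Composition n) ∧
    (∀ (π : Equiv.Perm (Fin n)) (β : Composition n),
      QSymWalk.Kbar Φ n (QSymWalk.descentComposition π) β =
        ∑ σ : Equiv.Perm (Fin n) with QSymWalk.descentComposition σ = β, QSymWalk.K Φ n π σ) ∧
    -- the unique stationary distributions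
    (∀ μ : Equiv.Perm (Fin n) → ℝ,
      QSymWalk.IsStationary (QSymWalk.K Φ n) μ ↔ μ = QSymWalk.uniformDist n) ∧
    (∀ μ : Composition n → ℝ,
      QSymWalk.IsStationary (QSymWalk.Kbar Φ n) μ ↔ μ = QSymWalk.descentDist n) ∧
    -- descent classes other than those of the identity and the longest element generate
    (∀ α : Composition n, α ≠ QSymWalk.onePart n → α ≠ Composition.ones n →
      Subgroup.closure {σ : Equiv.Perm (Fin n) | QSymWalk.descentComposition σ = α} = ⊤) := by
  obtain ⟨α, h1, h2, hα⟩ := hpos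
  have hscalar := QSymWalk.scalar_pow_pos hΦ hnonneg hα
  have hK := QSymWalk.K_mem_rowStochastic hΦ hnonneg hscalar
  have hKbar := QSymWalk.Kbar_mem_rowStochastic hΦ hnonneg hscalar
  refine ⟨hscalar, hK, hKbar, QSymWalk.Kbar_descentComposition hΦ, fun μ => ⟨fun hμ => ?_, ?_⟩,
    fun μ => ⟨fun hμ => ?_, ?_⟩, QSymWalk.closure_descentComposition_eq_top⟩
  · exact QSymWalk.IsStationary.unique hK
      (fun v hv => QSymWalk.harmonic_K_const hΦ hnonneg hα h1 h2 hv) hμ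
      (QSymWalk.isStationary_uniformDist hΦ hscalar)
  · rintro rfl
    exact QSymWalk.isStationary_uniformDist hΦ hscalar
  · exact QSymWalk.IsStationary.unique hKbar
      (fun v hv => QSymWalk.harmonic_Kbar_const hΦ hnonneg hα h1 h2 hv) hμ
      (QSymWalk.isStationary_descentDist hΦ hscalar)
  · rintro rfl
    exact QSymWalk.isStationary_descentDist hΦ hscalar
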